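/- Let $N\in\mathbb{N}\cup\{\infty\}$, and let $A$, $B$ be $N\times N$ matrices with integer entries, row-finite ($\sum_j|A_{i,j}|<\infty$ and $\sum_j|B_{i,j}|<\infty$ for every $i$) and without identically zero rows, with $A_{i,j}\ge 0$ for all $i,j$. Let $E$ be the directed graph with vertices $1,\dots,N$ and edges $e_{i,j,n}$, $0\le n<A_{i,j}$, from $s(e_{i,j,n})=i$ to $r(e_{i,j,n})=j$. For $m\in\mathbb{Z}$ write $mB_{i,j}+n=kA_{i,j}+l$ with $k,l\in\mathbb{Z}$, $0\le l<A_{i,j}$, and put $\kappa_m(e_{i,j,n})=e_{i,j,l}$, $\varphi(m,e_{i,j,n})=k$. Assume that the pair $A,B$ is pseudo free: if $m\in\mathbb{Z}$ and $e$ is an edge with $\kappa_m(e)=e$ and $\varphi(m,e)=0$, then $m=0$. Let $\mathbb{Z}$ act on the space $E^\infty$ of infinite paths $y_1y_2\cdots$ (edges $y_n$ with $r(y_n)=s(y_{n+1})$; topology induced by the product of discrete spaces) by $\kappa_m(y_1y_2\cdots)=\kappa_{m_1}(y_1)\kappa_{m_2}(y_2)\cdots$, where $m_1=m$, $m_{n+1}=\varphi(m_n,y_n)$.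 Let $\mathcal{G}_{A,B}$ be the groupoid of equivalence classes $[\alpha,m,\beta;x]$ of quadruples in which $\alpha,\beta$ are finite paths (vertices being the paths of length $0$) with $r(\alpha)=r(\beta)$, $m\in\mathbb{Z}$, and $x\in Z(\beta)$, the set of infinite paths starting with $\beta$, for the equivalence relation generated by $(\alpha,m,\beta;x)\sim(\alpha\kappa_m(\gamma),\varphi(m,\gamma),\beta\gamma;x)$ whenever $\gamma$ is an edge and $x=\beta\gamma y$. Its unit space is $E^\infty$, with $s[\alpha,m,\beta;\beta y]=\beta y$ and $r[\alpha,m,\beta;\beta y]=\alpha\kappa_m(y)$; the product is $[\alpha,m',\beta;\beta\kappa_m(y)]\cdot[\beta,m,\gamma;\gamma y]=[\alpha,m'+m,\gamma;\gamma y]$; the inverse is $[\alpha,m,\beta;\beta y]^{-1}=[\beta,-m,\alpha;\alpha\kappa_m(y)]$; and the sets $\{[\alpha,m,\beta;x]:x\in Z(\beta)\}$ form a basis of its topology, for which it is a Hausdorff étale groupoid. Let $\rho:\mathcal{G}_{A,B}\to\mathbb{Z}$ be the homomorphism $[\alpha,m,\beta;x]\mapsto|\alpha|-|\beta|$, where $|\cdot|$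 is the length of a path, and let $\mathcal{H}_{A,B}=\ker\rho$. For a Hausdorff étale groupoid $\mathcal{G}$ let $\mathcal{G}^{(n)}$ be the space of composable strings of $n$ arrows ($\mathcal{G}^{(0)}$ being the unit space), and let $H_n(\mathcal{G})$ be the $n$-th homology group of the chain complex of the groups $C_c(\mathcal{G}^{(n)},\mathbb{Z})$ of continuous compactly supported functions with the boundary maps $\delta_1=s_*-r_*$ and $\delta_n=\sum_{i=0}^n(-1)^i(d_i)_*$ for $n\ge 2$. Here $d_0$ and $d_n$ delete the first and the last entry of $(g_1,\dots,g_n)$, $d_i$ replaces $g_i,g_{i+1}$ by $g_ig_{i+1}$ for $1\le i\le n-1$, and $\pi_*(f)(y)=\sum_{\pi(x)=y}f(x)$ for a local homeomorphism $\pi$. Then $H_i(\mathcal{H}_{A,B})=0$ for all $i\ge 2$. -/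

import Mathlib

open scoped CompactlySupported

universe u

/-! ### Push-forward along local homeomorphisms -/

section Pushforward

variable {X Y Z : Type*} [TopologicalSpace X] [TopologicalSpace Y] [TopologicalSpace Z]

theorem isLocalHomeomorph_of_locallyInjective_of_isOpenMap {f : X → Y} (hc : Continuous f)
    (ho : IsOpenMap f) (hi : ∀ x, ∃ U : Set X, IsOpen U ∧ x ∈ U ∧ Set.InjOn f U) :
    IsLocalHomeomorph f := by
  rw [isLocalHomeomorph_iff_isOpenEmbedding_restrict]
  intro x
  obtain ⟨U, hU, hx, hinj⟩ := hi x
  refine ⟨U, hU.mem_nhds hx, .of_continuous_injective_isOpenMap ?_ ?_ ?_⟩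
  · exact hc.comp continuous_subtype_val
  · exact hinj.injective
  · exact ho.domRestrict hU

/-- The base change of a local homeomorphism is a local homeomorphism. -/
theorem IsLocalHomeomorph.of_isPullback {W : Type*} [TopologicalSpace W] {f : Y → Z} {b : X → Z}
    {q : W → X} {p : W → Y} (hf : IsLocalHomeomorph f) (hb : Continuous b)
    (hW : Topology.IsEmbedding fun w => (q w, p w)) (hcomm : ∀ w, b (q w) = f (p w))
    (hsurj : ∀ x y, b x = f y → ∃ w, q w = x ∧ p w = y) : IsLocalHomeomorph q := by
  have hq : Continuous q := continuous_fst.comp hW.continuous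
  have hp : Continuous p := continuous_snd.comp hW.continuous
  refine isLocalHomeomorph_of_locallyInjective_of_isOpenMap hq ?_ ?_
  · rw [isOpenMap_iff_nhds_le]
    intro w s hs
    rw [Filter.mem_map, hW.isInducing.nhds_eq_comap, Filter.mem_comap] at hs
    obtain ⟨t, ht, hts⟩ := hs
    obtain ⟨e, he, hfe⟩ := hf (p w)
    have hx : b (q w) ∈ e.target := by rw [hcomm, hfe]; exact e.map_source he
    have h1 : ∀ᶠ x in nhds (q w), b x ∈ e.target :=
      hb.continuousAt.eventually (e.open_target.mem_nhds hx)
    have h0 : e.symm (b (q w)) = p w := by rw [hcomm, hfe, e.left_inv he]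
    have hcont : ContinuousAt (fun x => (x, e.symm (b x))) (q w) :=
      continuousAt_id.prodMk ((e.continuousAt_symm hx).comp hb.continuousAt)
    have h2 : ∀ᶠ x in nhds (q w), (x, e.symm (b x)) ∈ t := by
      apply hcont.eventually
      change t ∈ nhds (q w, e.symm (b (q w)))
      rwa [h0]
    filter_upwards [h1, h2] with x hx1 hx2
    obtain ⟨w', hw1, hw2⟩ := hsurj x (e.symm (b x)) (by rw [hfe, e.right_inv hx1])
    have : w' ∈ q ⁻¹' s := hts (by simpa only [Set.mem_preimage, hw1, hw2] using hx2)
    rwa [← hw1]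
  · intro w
    obtain ⟨e, he, hfe⟩ := hf (p w)
    refine ⟨p ⁻¹' e.source, e.open_source.preimage hp, he, ?_⟩
    intro a ha c hc hac
    apply hW.injective
    refine Prod.ext hac (e.injOn ha hc ?_)
    rw [← hfe, ← hcomm, hac, hcomm]

theorem finite_fiber_inter_support [T2Space X] [T1Space Y] {π : X → Y} (hπ : IsLocalHomeomorph π)
    (f : C_c(X, ℤ)) (y : Y) : (π ⁻¹' {y} ∩ tsupport f).Finite := by
  have hK : IsCompact (π ⁻¹' {y} ∩ tsupport f) :=
    f.hasCompactSupport.isCompact.inter_left (isClosed_singleton.preimage hπ.continuous)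
  refine hK.finite ?_
  refine IsDiscrete.mono (s := π ⁻¹' {y}) ?_ Set.inter_subset_left
  exact (hπ.isLocalHomeomorphOn (s := _)).isDiscrete_of_image
    (Set.Subsingleton.isDiscrete (by rintro _ ⟨a, ha, rfl⟩ _ ⟨b, hb, rfl⟩; exact ha.trans hb.symm))

theorem finite_fiber_support [T2Space X] [T1Space Y] {π : X → Y} (hπ : IsLocalHomeomorph π)
    (f : C_c(X, ℤ)) (y : Y) : (π ⁻¹' {y} ∩ Function.support f).Finite :=
  (finite_fiber_inter_support hπ f y).subset
    (Set.inter_subset_inter_right _ (subset_tsupport f))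

theorem continuous_fiberSum [T2Space X] [T2Space Y] {π : X → Y} (hπ : IsLocalHomeomorph π)
    (f : C_c(X, ℤ)) : Continuous fun y => ∑ᶠ x ∈ π ⁻¹' {y}, f x := by
  classical
  rw [continuous_iff_continuousAt]
  intro y
  have hfin := finite_fiber_inter_support hπ f y
  obtain ⟨U, hU, hdisj⟩ := hfin.t2_separation
  -- shrink the separating neighbourhoods
  have hV : ∀ x, ∃ V : Set X, IsOpen V ∧ x ∈ V ∧ V ⊆ U x ∧ Set.InjOn π V ∧ ∀ z ∈ V, f z = f x := by
    intro x
    obtain ⟨e, he, hfe⟩ := hπ x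
    refine ⟨U x ∩ e.source ∩ f ⁻¹' {f x}, ((hU x).2.inter e.open_source).inter
      ((isOpen_discrete _).preimage f.continuous), ⟨⟨(hU x).1, he⟩, rfl⟩, ?_, ?_, ?_⟩
    · exact fun z hz => hz.1.1
    · rw [hfe]; exact e.injOn.mono fun z hz => hz.1.2
    · exact fun z hz => hz.2
  choose V hVo hxV hVU hVinj hVf using hV
  set F := hfin.toFinset with hF
  have hrest : IsClosed (π '' (tsupport f \ ⋃ x ∈ F, V x)) :=
    ((f.hasCompactSupport.isCompact.diff (isOpen_biUnion fun x _ => hVo x)).image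
      hπ.continuous).isClosed
  have h1 : ∀ᶠ z in nhds y, z ∉ π '' (tsupport f \ ⋃ x ∈ F, V x) := by
    refine hrest.isOpen_compl.mem_nhds ?_
    rintro ⟨x, ⟨hx1, hx2⟩, hxy⟩
    apply hx2
    simp only [Set.mem_iUnion]
    exact ⟨x, by simp [hF, hxy, hx1], hxV x⟩
  have h2 : ∀ᶠ z in nhds y, ∀ x ∈ F, z ∈ π '' V x := by
    rw [Filter.eventually_all_finset]
    intro x hx
    have hxy : π x = y := by
      have := (Set.Finite.mem_toFinset hfin).1 hx
      exact this.1
    exact (hπ.isOpenMap _ (hVo x)).mem_nhds ⟨x, hxV x, hxy⟩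
  have key : ∀ z, z ∉ π '' (tsupport f \ ⋃ x ∈ F, V x) → (∀ x ∈ F, z ∈ π '' V x) →
      ∑ᶠ x ∈ π ⁻¹' {z}, f x = ∑ x ∈ F, f x := by
    intro z hz1 hz2
    choose g hgV hgπ using hz2
    have hs : π ⁻¹' {z} ∩ Function.support f ⊆ (F.attach.image fun x => g x.1 x.2 : Finset X) := by
      rintro w ⟨hw1, hw2⟩
      have hw3 : w ∈ ⋃ x ∈ F, V x := by
        by_contra hcon
        exact hz1 ⟨w, ⟨subset_tsupport f hw2, hcon⟩, hw1⟩
      simp only [Set.mem_iUnion] at hw3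
      obtain ⟨x, hx, hwx⟩ := hw3
      have : g x hx = w := hVinj x (hgV x hx) hwx ((hgπ x hx).trans hw1.symm)
      simp only [Finset.coe_image, Set.mem_image, Finset.mem_coe, Finset.mem_attach, true_and,
        Subtype.exists]
      exact ⟨x, hx, this⟩
    have hs' : ((F.attach.image fun x => g x.1 x.2 : Finset X) : Set X) ⊆ π ⁻¹' {z} := by
      intro w hw
      simp only [Finset.coe_image, Set.mem_image, Finset.mem_coe, Finset.mem_attach, true_and,
        Subtype.exists] at hw
      obtain ⟨x, hx, rfl⟩ := hw
      exact hgπ x hx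
    rw [finsum_mem_eq_sum_of_subset f hs hs', Finset.sum_image, ← Finset.sum_attach F]
    · exact Finset.sum_congr rfl fun x _ => hVf x.1 _ (hgV x.1 x.2)
    · rintro ⟨a, ha⟩ - ⟨b, hb⟩ - hab
      by_contra hne
      have hne' : a ≠ b := fun h => hne (Subtype.ext h)
      have hd := hdisj ((Set.Finite.mem_toFinset hfin).1 ha) ((Set.Finite.mem_toFinset hfin).1 hb)
        hne'
      refine Set.disjoint_left.1 hd (hVU a (hgV a ha)) ?_
      have : g a ha = g b hb := hab
      rw [this]
      exact hVU b (hgV b hb)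
  have h3 : ∀ᶠ z in nhds y, ∑ᶠ x ∈ π ⁻¹' {z}, f x = ∑ x ∈ F, f x := by
    filter_upwards [h1, h2] with z hz1 hz2 using key z hz1 hz2
  refine ContinuousAt.congr (f := fun _ => ∑ x ∈ F, f x) continuousAt_const ?_
  filter_upwards [h3] with z hz using hz.symm

/-- The push-forward `π_* f (y) = ∑_{π x = y} f x` along a local homeomorphism of Hausdorff
spaces. For `f` in `C_c(X, ℤ)` each of these sums has only finitely many nonzero terms. -/
noncomputable def pushforward [T2Space X] [T2Space Y] (π : X → Y) (hπ : IsLocalHomeomorph π) :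
    C_c(X, ℤ) →+ C_c(Y, ℤ) where
  toFun f :=
    { toFun := fun y => ∑ᶠ x ∈ π ⁻¹' {y}, f x
      continuous_toFun := continuous_fiberSum hπ f
      hasCompactSupport' := by
        refine HasCompactSupport.intro (f.hasCompactSupport.isCompact.image hπ.continuous) ?_
        intro y hy
        refine finsum_mem_eq_zero_of_forall_eq_zero fun x hx => ?_
        by_contra hne
        exact hy ⟨x, subset_tsupport f hne, hx⟩ }
  map_zero' := by
    ext y
    simp
  map_add' f g := by
    ext y
    exact finsum_mem_add_distrib' (finite_fiber_support hπ f y) (finite_fiber_support hπ g y)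

theorem pushforward_apply [T2Space X] [T2Space Y] {π : X → Y} (hπ : IsLocalHomeomorph π)
    (f : C_c(X, ℤ)) (y : Y) : pushforward π hπ f y = ∑ᶠ x ∈ π ⁻¹' {y}, f x := rfl

theorem pushforward_comp [T2Space X] [T2Space Y] [T2Space Z] {π : X → Y} {τ : Y → Z}
    (hπ : IsLocalHomeomorph π) (hτ : IsLocalHomeomorph τ) (f : C_c(X, ℤ)) :
    pushforward τ hτ (pushforward π hπ f) = pushforward (τ ∘ π) (hτ.comp hπ) f := by
  classical
  ext z
  simp only [pushforward_apply]
  have hfin : ((τ ∘ π) ⁻¹' {z} ∩ Function.support f).Finite :=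
    finite_fiber_support (hτ.comp hπ) f z
  set T := hfin.toFinset with hT
  have hmem : ∀ x, x ∈ T ↔ τ (π x) = z ∧ f x ≠ 0 := fun x => by simp [hT]
  have h1 : ∀ y ∈ τ ⁻¹' {z}, ∑ᶠ x ∈ π ⁻¹' {y}, f x = ∑ x ∈ T with π x = y, f x := by
    intro y hy
    refine finsum_mem_eq_sum_of_subset f ?_ ?_
    · rintro x ⟨hx1, hx2⟩
      rw [Finset.mem_coe, Finset.mem_filter, hmem]
      have hx1' : π x = y := hx1
      exact ⟨⟨by rw [hx1']; exact hy, hx2⟩, hx1⟩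
    · intro x hx
      exact (Finset.mem_filter.1 hx).2
  rw [finsum_mem_congr rfl h1, finsum_mem_eq_sum_of_subset (t := T.image π),
    Finset.sum_fiberwise_of_maps_to (fun x hx => Finset.mem_image_of_mem π hx)]
  · refine (finsum_mem_eq_sum_of_subset f (fun x hx => ?_) fun x hx => ?_).symm
    · exact (hmem x).2 hx
    · exact ((hmem x).1 hx).1
  · rintro y ⟨-, hy⟩
    obtain ⟨x, hx, -⟩ := Finset.exists_ne_zero_of_sum_ne_zero hy
    obtain ⟨hx1, hx2⟩ := Finset.mem_filter.1 hx
    rw [Finset.mem_coe, ← hx2]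
    exact Finset.mem_image_of_mem π hx1
  · intro y hy
    obtain ⟨x, hx, rfl⟩ := Finset.mem_image.1 hy
    exact ((hmem x).1 hx).1

end Pushforward

/-! ### Étale groupoids and their homology -/

/-- A Hausdorff étale groupoid: a topological groupoid with space of arrows `Arr` and space of
units `Obj` (embedded in `Arr` by `one`) whose range map is a local homeomorphism.
`mul g h` is the product `g h`; it is meaningful only if `src g = rng h`. -/
structure EtaleGroupoid where
  Obj : Type u
  Arr : Type u
  [topObj : TopologicalSpace Obj]
  [topArr : TopologicalSpace Arr]
  [t2Obj : T2Space Obj]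
  [t2Arr : T2Space Arr]
  src : Arr → Obj
  rng : Arr → Obj
  one : Obj → Arr
  inv : Arr → Arr
  mul : Arr → Arr → Arr
  src_one : ∀ x, src (one x) = x
  rng_one : ∀ x, rng (one x) = x
  src_inv : ∀ g, src (inv g) = rng g
  rng_inv : ∀ g, rng (inv g) = src g
  src_mul : ∀ g h, src g = rng h → src (mul g h) = src h
  rng_mul : ∀ g h, src g = rng h → rng (mul g h) = rng g
  mul_assoc : ∀ g h k, src g = rng h → src h = rng k → mul (mul g h) k = mul g (mul h k)
  one_mul : ∀ g, mul (one (rng g)) g = g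
  mul_one : ∀ g, mul g (one (src g)) = g
  inv_mul : ∀ g, mul (inv g) g = one (src g)
  mul_inv : ∀ g, mul g (inv g) = one (rng g)
  continuous_one : Continuous one
  continuous_inv : Continuous inv
  continuous_mul : Continuous fun p : {p : Arr × Arr // src p.1 = rng p.2} => mul p.1.1 p.1.2
  isLocalHomeomorph_src : IsLocalHomeomorph src
  isLocalHomeomorph_rng : IsLocalHomeomorph rng

namespace EtaleGroupoid

instance (G : EtaleGroupoid.{u}) : TopologicalSpace G.Obj := G.topObj
instance (G : EtaleGroupoid.{u}) : TopologicalSpace G.Arr := G.topArr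
instance (G : EtaleGroupoid.{u}) : T2Space G.Obj := G.t2Obj
instance (G : EtaleGroupoid.{u}) : T2Space G.Arr := G.t2Arr

variable (G : EtaleGroupoid.{u})

/-- The space `G^(n)` of composable strings `(g_1, …, g_n)`, with `G^(0)` the unit space. -/
def Strings : ℕ → Type u
  | 0 => G.Obj
  | n + 1 => {g : Fin (n + 1) → G.Arr // ∀ i : Fin n, G.src (g i.castSucc) = G.rng (g i.succ)}

instance : (n : ℕ) → TopologicalSpace (G.Strings n)
  | 0 => inferInstanceAs (TopologicalSpace G.Obj)
  | n + 1 => inferInstanceAs (TopologicalSpace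
      {g : Fin (n + 1) → G.Arr // ∀ i : Fin n, G.src (g i.castSucc) = G.rng (g i.succ)})

instance : (n : ℕ) → T2Space (G.Strings n)
  | 0 => inferInstanceAs (T2Space G.Obj)
  | n + 1 => inferInstanceAs (T2Space
      {g : Fin (n + 1) → G.Arr // ∀ i : Fin n, G.src (g i.castSucc) = G.rng (g i.succ)})

variable {G}

theorem composable_tail {n : ℕ} {g : Fin (n + 2) → G.Arr}
    (hg : ∀ i : Fin (n + 1), G.src (g i.castSucc) = G.rng (g i.succ)) (i : Fin n) :
    G.src (g i.castSucc.succ) = G.rng (g i.succ.succ) := by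
  simpa using hg i.succ

theorem composable_contractNth {n : ℕ} {g : Fin (n + 2) → G.Arr}
    (hg : ∀ i : Fin (n + 1), G.src (g i.castSucc) = G.rng (g i.succ)) (j : Fin (n + 2))
    (i : Fin n) : G.src (j.contractNth G.mul g i.castSucc) =
      G.rng (j.contractNth G.mul g i.succ) := by
  have h1 : G.src (g i.castSucc.castSucc) = G.rng (g i.castSucc.succ) := hg i.castSucc
  have h2 : G.src (g i.castSucc.succ) = G.rng (g i.succ.succ) := composable_tail hg i
  unfold Fin.contractNth
  simp only [Fin.val_castSucc, Fin.val_succ]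
  have h3 : i.succ.castSucc = i.castSucc.succ := rfl
  split_ifs <;> first | omega | skip
  · rw [h3, h1]
  · rw [h3, h1, G.rng_mul _ _ h2]
  · rw [G.src_mul _ _ h1, h2]

variable (G)

/-- The face maps `d_i : G^(n+1) → G^(n)`. On `G^(1)` they are `d_0 = s` and `d_1 = r`; on longer
strings `d_0` and the last one drop the first and the last entry, and for `i` in between
`d_i (g_1, …) = (g_1, …, g_i g_{i+1}, …)`. (`Fin.contractNth j` multiplies the entries number `j`
and `j + 1`, counted from `0`, and drops the last entry if `j` is the last index.) -/
def face : (n : ℕ) → Fin (n + 2) → G.Strings (n + 1) → G.Strings n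
  | 0, i, g => Fin.cases (G.src (g.1 0)) (fun _ => G.rng (g.1 0)) i
  | _ + 1, i, g => Fin.cases
      (⟨fun k => g.1 k.succ, composable_tail g.2⟩)
      (fun j => ⟨j.contractNth G.mul g.1, composable_contractNth g.2 j⟩) i

/-- The range of the first entry of a string. -/
def firstUnit : (n : ℕ) → G.Strings n → G.Obj
  | 0, x => x
  | _ + 1, g => G.rng (g.1 0)

/-- The source of the last entry of a string. -/
def lastUnit : (n : ℕ) → G.Strings n → G.Obj
  | 0, x => x
  | n + 1, g => G.src (g.1 (Fin.last n))

theorem continuous_firstUnit : (n : ℕ) → Continuous (G.firstUnit n)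
  | 0 => continuous_id
  | _ + 1 => G.isLocalHomeomorph_rng.continuous.comp
      ((continuous_apply 0).comp continuous_subtype_val)

theorem continuous_contractNth {n : ℕ} (j : Fin (n + 2)) (k : Fin (n + 1)) :
    Continuous fun g : G.Strings (n + 2) => j.contractNth G.mul g.1 k := by
  have hk : ∀ i, Continuous fun g : G.Strings (n + 2) => g.1 i := fun i =>
    (continuous_apply i).comp continuous_subtype_val
  unfold Fin.contractNth
  split_ifs
  · exact hk _
  · exact G.continuous_mul.comp
      (Continuous.subtype_mk ((hk k.castSucc).prodMk (hk k.succ)) fun g => g.2 k)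
  · exact hk _

theorem continuous_face (n : ℕ) (i : Fin (n + 2)) : Continuous (G.face n i) := by
  have hk : ∀ {n} i, Continuous fun g : G.Strings (n + 1) => g.1 i := fun i =>
    (continuous_apply i).comp continuous_subtype_val
  cases n with
  | zero =>
    induction i using Fin.cases with
    | zero => exact G.isLocalHomeomorph_src.continuous.comp (hk 0)
    | succ j => exact G.isLocalHomeomorph_rng.continuous.comp (hk 0)
  | succ n =>
    induction i using Fin.cases with
    | zero => exact Continuous.subtype_mk (continuous_pi fun k => hk _) _
    | succ j => exact Continuous.subtype_mk (continuous_pi fun k => G.continuous_contractNth j k) _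

theorem isLocalHomeomorph_face_zero (n : ℕ) : IsLocalHomeomorph (G.face n 0) := by
  refine G.isLocalHomeomorph_src.of_isPullback (b := G.firstUnit n) (p := fun g => g.1 0)
    (G.continuous_firstUnit n) ?_ ?_ ?_
  · cases n with
    | zero =>
      have h : Topology.IsEmbedding fun g : G.Strings 1 => g.1 0 :=
        (Homeomorph.funUnique (Fin 1) G.Arr).isEmbedding.comp Topology.IsEmbedding.subtypeVal
      exact .of_comp (g := Prod.snd)
        ((G.continuous_face 0 0).prodMk h.continuous) continuous_snd h
    | succ n =>
      refine .of_comp (g := fun p : G.Strings (n + 1) × G.Arr =>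
        (Fin.cons p.2 p.1.1 : Fin (n + 2) → G.Arr))
        ((G.continuous_face (n + 1) 0).prodMk
          ((continuous_apply 0).comp continuous_subtype_val)) ?_ ?_
      · exact Continuous.finCons continuous_snd (continuous_subtype_val.comp continuous_fst)
      · convert! (Topology.IsEmbedding.subtypeVal : Topology.IsEmbedding fun g : {g : Fin (n + 2) →
          G.Arr // ∀ i : Fin (n + 1), G.src (g i.castSucc) = G.rng (g i.succ)} => g.1) using 1
        funext g
        exact Fin.cons_self_tail g.1
  · intro w
    cases n with
    | zero => rfl
    | succ n => exact (w.2 0).symm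
  · intro x y hxy
    cases n with
    | zero => exact ⟨⟨fun _ => y, fun i => i.elim0⟩, hxy.symm, rfl⟩
    | succ n =>
      refine ⟨⟨Fin.cons y x.1, fun i => ?_⟩, rfl, rfl⟩
      induction i using Fin.cases with
      | zero => exact hxy.symm
      | succ i => exact x.2 i

theorem isLocalHomeomorph_lastUnit (n : ℕ) : IsLocalHomeomorph (G.lastUnit n) := by
  induction n with
  | zero => exact (Homeomorph.refl G.Obj).isLocalHomeomorph
  | succ n ih =>
    have : G.lastUnit (n + 1) = G.lastUnit n ∘ G.face n 0 := by
      funext g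
      cases n <;> rfl
    rw [this]
    exact ih.comp (G.isLocalHomeomorph_face_zero n)

theorem isLocalHomeomorph_lastArr (n : ℕ) :
    IsLocalHomeomorph fun g : G.Strings (n + 1) => g.1 (Fin.last n) :=
  IsLocalHomeomorph.of_comp (g := G.src) (G.isLocalHomeomorph_lastUnit (n + 1))
    G.isLocalHomeomorph_src ((continuous_apply _).comp continuous_subtype_val)

theorem lastUnit_face (n : ℕ) (i : Fin (n + 2)) (g : G.Strings (n + 1)) :
    G.lastUnit n (G.face n i g) =
      if (i : ℕ) = n + 1 then G.rng (g.1 (Fin.last n)) else G.src (g.1 (Fin.last n)) := by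
  cases n with
  | zero => fin_cases i <;> rfl
  | succ n =>
    induction i using Fin.cases with
    | zero => rfl
    | succ j =>
      have h := g.2 (Fin.last n)
      change G.src (j.contractNth G.mul g.1 (Fin.last n)) = _
      unfold Fin.contractNth
      simp only [Fin.val_last, Fin.val_succ]
      have := j.2
      split_ifs <;> first | omega | skip
      · exact h
      · exact G.src_mul _ _ h
      · rfl

theorem isLocalHomeomorph_face (n : ℕ) (i : Fin (n + 2)) : IsLocalHomeomorph (G.face n i) := by
  refine IsLocalHomeomorph.of_comp (g := G.lastUnit n) ?_ (G.isLocalHomeomorph_lastUnit n)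
    (G.continuous_face n i)
  have h : G.lastUnit n ∘ G.face n i = fun g => if (i : ℕ) = n + 1 then
      G.rng (g.1 (Fin.last n)) else G.src (g.1 (Fin.last n)) :=
    funext (G.lastUnit_face n i)
  rw [h]
  split_ifs
  · exact G.isLocalHomeomorph_rng.comp (G.isLocalHomeomorph_lastArr n)
  · exact G.isLocalHomeomorph_src.comp (G.isLocalHomeomorph_lastArr n)

/-- The boundary map `δ_{n+1} = ∑_i (-1)^i d_{i*} : C_c(G^(n+1), ℤ) → C_c(G^(n), ℤ)`;
in particular `δ_1 = s_* - r_*`. -/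
noncomputable def boundary (n : ℕ) : C_c(G.Strings (n + 1), ℤ) →+ C_c(G.Strings n, ℤ) :=
  ∑ i : Fin (n + 2), (-1 : ℤ) ^ (i : ℕ) • pushforward (G.face n i) (G.isLocalHomeomorph_face n i)

theorem face_succ_apply {n : ℕ} (i : Fin (n + 3)) (g : G.Strings (n + 2)) (k : Fin (n + 1)) :
    (G.face (n + 1) i g).1 k = if (k : ℕ) + 1 < i then g.1 k.castSucc else
      if (k : ℕ) + 1 = i then G.mul (g.1 k.castSucc) (g.1 k.succ) else g.1 k.succ := by
  induction i using Fin.cases with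
  | zero => simp; rfl
  | succ j =>
    change j.contractNth G.mul g.1 k = _
    unfold Fin.contractNth
    simp only [Fin.val_succ, Nat.add_lt_add_iff_right, Nat.add_right_cancel_iff]

theorem face_face {n : ℕ} (i : Fin (n + 2)) (j : Fin (n + 2)) (hij : i ≤ j)
    (g : G.Strings (n + 2)) :
    G.face n i (G.face (n + 1) j.succ g) = G.face n j (G.face (n + 1) i.castSucc g) := by
  cases n with
  | zero =>
    have h : G.src (g.1 0) = G.rng (g.1 1) := g.2 0
    fin_cases i <;> fin_cases j
    · exact G.src_mul _ _ h
    · exact h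
    · exact absurd hij (by decide)
    · exact (G.rng_mul _ _ h).symm
  | succ n =>
    refine Subtype.ext (funext fun k => ?_)
    have h1 := g.2 k.castSucc
    have h2 := g.2 k.succ
    rw [Fin.le_def] at hij
    simp only [face_succ_apply, Fin.val_castSucc, Fin.val_succ]
    split_ifs <;> first | omega | rfl | skip
    exact (G.mul_assoc _ _ _ h1 h2).symm

theorem boundary_boundary (n : ℕ) (f : C_c(G.Strings (n + 2), ℤ)) :
    G.boundary n (G.boundary (n + 1) f) = 0 := by
  simp only [boundary, AddMonoidHom.finsetSum_apply, AddMonoidHom.smul_apply, map_sum, map_zsmul,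
    Finset.smul_sum, smul_smul, pushforward_comp]
  rw [Finset.sum_comm]
  simp only [← Finset.sum_product']
  let P := Fin (n + 2) × Fin (n + 3)
  let S : Finset P := {ij : P | (ij.2 : ℕ) ≤ (ij.1 : ℕ)}
  rw [Finset.univ_product_univ, ← Finset.sum_add_sum_compl S, ← eq_neg_iff_add_eq_zero,
    ← Finset.sum_neg_distrib]
  let φ : ∀ ij : P, ij ∈ S → P := fun ij hij =>
    (Fin.castLT ij.2 (lt_of_le_of_lt (Finset.mem_filter.mp hij).right (Fin.is_lt ij.1)), ij.1.succ)
  apply Finset.sum_bij φ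
  · intro ij hij
    simp_rw [S, φ, Finset.compl_filter, Finset.mem_filter_univ, Fin.val_succ,
      Fin.val_castLT] at hij ⊢
    omega
  · rintro ⟨i, j⟩ hij ⟨i', j'⟩ hij' h
    rw [Prod.mk_inj]
    exact ⟨by simpa [φ] using! congr_arg Prod.snd h,
      by simpa [φ, Fin.castSucc_castLT] using! congr_arg Fin.castSucc (congr_arg Prod.fst h)⟩
  · rintro ⟨i', j'⟩ hij'
    simp_rw [S, Finset.compl_filter, Finset.mem_filter_univ, not_le] at hij'
    refine ⟨(j'.pred <| ?_, Fin.castSucc i'), ?_, ?_⟩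
    · rintro rfl
      simp only [Fin.val_zero, not_lt_zero] at hij'
    · simpa [S] using! Nat.le_sub_one_of_lt hij'
    · simp only [φ, Fin.castLT_castSucc, Fin.succ_pred]
  · rintro ⟨i, j⟩ hij
    have hji : (j : ℕ) ≤ i := by simpa [S] using hij
    rw [← neg_smul]
    congr 1
    · simp only [φ, Fin.val_succ, Fin.val_castLT]
      ring
    · have : G.face n i ∘ G.face (n + 1) j =
          G.face n (φ (i, j) hij).1 ∘ G.face (n + 1) (φ (i, j) hij).2 := by
        funext g
        exact (G.face_face (j.castLT (lt_of_le_of_lt hji i.2)) i hji g).symm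
      simp only [this]

/-- The cycles: the kernel of `δ_n`, where `δ_0 = 0`. -/
noncomputable def cycles : (n : ℕ) → AddSubgroup C_c(G.Strings n, ℤ)
  | 0 => ⊤
  | n + 1 => (G.boundary n).ker

/-- The homology group `H_n(G) = ker δ_n / im δ_{n+1}` of the chain complex `C_c(G^(•), ℤ)`
(a chain complex by `boundary_boundary`). -/
def Homology (n : ℕ) : Type u :=
  G.cycles n ⧸ (G.boundary n).range.addSubgroupOf (G.cycles n)

noncomputable instance (n : ℕ) : AddCommGroup (G.Homology n) :=
  inferInstanceAs (AddCommGroup (G.cycles n ⧸ (G.boundary n).range.addSubgroupOf (G.cycles n)))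

/-- A continuous groupoid homomorphism from `G` to the (discrete) group `ℤ`. -/
structure IntHom where
  toFun : G.Arr → ℤ
  map_mul : ∀ g h, G.src g = G.rng h → toFun (G.mul g h) = toFun g + toFun h
  continuous_toFun : Continuous toFun

variable {G}

namespace IntHom

theorem map_one (ρ : G.IntHom) (x : G.Obj) : ρ.toFun (G.one x) = 0 := by
  have h := ρ.map_mul (G.one x) (G.one x) (by rw [G.src_one, G.rng_one])
  have h1 : G.mul (G.one x) (G.one x) = G.one x := by
    simpa only [G.rng_one] using G.one_mul (G.one x)
  rw [h1] at h
  omega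

theorem map_inv (ρ : G.IntHom) (g : G.Arr) : ρ.toFun (G.inv g) = -ρ.toFun g := by
  have h := ρ.map_mul (G.inv g) g (G.src_inv g)
  rw [G.inv_mul, ρ.map_one] at h
  omega

/-- The inverse of `G` restricted to the kernel of `ρ`. -/
def kerInv (ρ : G.IntHom) (g : {g : G.Arr // ρ.toFun g = 0}) : {g : G.Arr // ρ.toFun g = 0} :=
  ⟨G.inv g.1, by rw [ρ.map_inv, g.2, neg_zero]⟩

theorem isLocalHomeomorph_kerVal (ρ : G.IntHom) :
    IsLocalHomeomorph (Subtype.val : {g : G.Arr // ρ.toFun g = 0} → G.Arr) :=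
  ((isOpen_discrete {(0 : ℤ)}).preimage
    ρ.continuous_toFun).isOpenEmbedding_subtypeVal.isLocalHomeomorph

open scoped Classical in
/-- The product of `G` restricted to the kernel of `ρ`; the value on pairs that are not composable
is irrelevant. -/
noncomputable def kerMul (ρ : G.IntHom) (g h : {g : G.Arr // ρ.toFun g = 0}) :
    {g : G.Arr // ρ.toFun g = 0} :=
  if hgh : G.src g.1 = G.rng h.1 then
    ⟨G.mul g.1 h.1, by rw [ρ.map_mul _ _ hgh, g.2, h.2, add_zero]⟩ else g

theorem kerMul_val (ρ : G.IntHom) (g h : {g : G.Arr // ρ.toFun g = 0})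
    (hgh : G.src g.1 = G.rng h.1) : (ρ.kerMul g h).1 = G.mul g.1 h.1 := by
  rw [kerMul, dif_pos hgh]

theorem continuous_kerMul (ρ : G.IntHom) :
    Continuous fun p : {p : {g : G.Arr // ρ.toFun g = 0} × {g : G.Arr // ρ.toFun g = 0} //
      G.src p.1.1 = G.rng p.2.1} => ρ.kerMul p.1.1 p.1.2 := by
  refine Topology.IsInducing.subtypeVal.continuous_iff.2 ?_
  have h : Continuous fun p : {p : {g : G.Arr // ρ.toFun g = 0} × {g : G.Arr // ρ.toFun g = 0} //
      G.src p.1.1 = G.rng p.2.1} => (⟨(p.1.1.1, p.1.2.1), p.2⟩ :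
        {p : G.Arr × G.Arr // G.src p.1 = G.rng p.2}) := by fun_prop
  refine (G.continuous_mul.comp h).congr fun p => ?_
  exact (ρ.kerMul_val _ _ p.2).symm

/-- The kernel of a continuous homomorphism `ρ : G → ℤ`: the open subgroupoid of the arrows `g`
with `ρ g = 0`, with the subspace topology and the same units as `G`. -/
noncomputable def ker (ρ : G.IntHom) : EtaleGroupoid.{u} where
  Obj := G.Obj
  Arr := {g : G.Arr // ρ.toFun g = 0}
  src g := G.src g.1
  rng g := G.rng g.1
  one x := ⟨G.one x, ρ.map_one x⟩
  inv := ρ.kerInv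
  mul := ρ.kerMul
  src_one x := G.src_one x
  rng_one x := G.rng_one x
  src_inv g := G.src_inv g.1
  rng_inv g := G.rng_inv g.1
  src_mul g h hgh := by rw [ρ.kerMul_val _ _ hgh, G.src_mul _ _ hgh]
  rng_mul g h hgh := by rw [ρ.kerMul_val _ _ hgh, G.rng_mul _ _ hgh]
  mul_assoc g h k hgh hhk := by
    have h1 : G.src (ρ.kerMul g h).1 = G.rng k.1 := by
      rw [ρ.kerMul_val _ _ hgh, G.src_mul _ _ hgh, hhk]
    have h2 : G.src g.1 = G.rng (ρ.kerMul h k).1 := by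
      rw [ρ.kerMul_val _ _ hhk, G.rng_mul _ _ hhk, hgh]
    apply Subtype.ext
    rw [ρ.kerMul_val _ _ h1, ρ.kerMul_val _ _ h2, ρ.kerMul_val _ _ hgh, ρ.kerMul_val _ _ hhk,
      G.mul_assoc _ _ _ hgh hhk]
  one_mul g := Subtype.ext ((ρ.kerMul_val _ _ (G.src_one _)).trans (G.one_mul g.1))
  mul_one g := Subtype.ext ((ρ.kerMul_val _ _ (G.rng_one _).symm).trans (G.mul_one g.1))
  inv_mul g := Subtype.ext ((ρ.kerMul_val _ _ (G.src_inv _)).trans (G.inv_mul g.1))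
  mul_inv g := Subtype.ext ((ρ.kerMul_val _ _ (G.rng_inv _).symm).trans (G.mul_inv g.1))
  continuous_one := G.continuous_one.subtype_mk _
  continuous_inv := (G.continuous_inv.comp continuous_subtype_val).subtype_mk _
  continuous_mul := ρ.continuous_kerMul
  isLocalHomeomorph_src := G.isLocalHomeomorph_src.comp ρ.isLocalHomeomorph_kerVal
  isLocalHomeomorph_rng := G.isLocalHomeomorph_rng.comp ρ.isLocalHomeomorph_kerVal

end IntHom

end EtaleGroupoid

/-! ### The Katsura–Exel–Pardo groupoid -/

namespace Katsura

variable {V : Type u}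

/-- The edges `e_{i,j,n}`, `0 ≤ n < A i j`, of the graph of `A`, from `src = i` to `rng = j`. -/
@[ext]
structure Edge (A : Matrix V V ℤ) where
  src : V
  rng : V
  idx : ℤ
  idx_nonneg : 0 ≤ idx
  idx_lt : idx < A src rng

/-- A matrix with integer entries is row-finite, `∑_j |A i j| < ∞` for all `i`, if and only if
each of its rows has finitely many nonzero entries. -/
def RowFinite (A : Matrix V V ℤ) : Prop := ∀ i, {j | A i j ≠ 0}.Finite

variable {A : Matrix V V ℤ} (B : Matrix V V ℤ)

theorem Edge.pos (e : Edge A) : 0 < A e.src e.rng := e.idx_nonneg.trans_lt e.idx_lt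

/-- The action of `m : ℤ` on edges: `κ_m (e_{i,j,n}) = e_{i,j,l}` where
`m B_{i,j} + n = k A_{i,j} + l` and `0 ≤ l < A_{i,j}`. -/
def kappa (m : ℤ) (e : Edge A) : Edge A where
  src := e.src
  rng := e.rng
  idx := (m * B e.src e.rng + e.idx) % A e.src e.rng
  idx_nonneg := Int.emod_nonneg _ e.pos.ne'
  idx_lt := Int.emod_lt_of_pos _ e.pos

/-- The one-cocycle `φ (m, e_{i,j,n}) = k` where `m B_{i,j} + n = k A_{i,j} + l` and
`0 ≤ l < A_{i,j}`. -/
def phi (m : ℤ) (e : Edge A) : ℤ := (m * B e.src e.rng + e.idx) / A e.src e.rng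

/-- The pair `A`, `B` is pseudo free. -/
def PseudoFree (A B : Matrix V V ℤ) : Prop :=
  ∀ (m : ℤ) (e : Edge A), kappa B m e = e → phi B m e = 0 → m = 0

theorem kappa_add (m₁ m₂ : ℤ) (e : Edge A) :
    kappa B (m₁ + m₂) e = kappa B m₁ (kappa B m₂ e) := by
  refine Edge.ext rfl rfl ?_
  simp only [kappa, Int.add_emod_emod]
  ring_nf

theorem phi_add (m₁ m₂ : ℤ) (e : Edge A) :
    phi B (m₁ + m₂) e = phi B m₁ (kappa B m₂ e) + phi B m₂ e := by
  simp only [phi, kappa]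
  rw [← Int.add_mul_ediv_left _ _ e.pos.ne', add_assoc, Int.emod_add_mul_ediv]
  ring_nf

theorem kappa_zero (e : Edge A) : kappa B 0 e = e := by
  refine Edge.ext rfl rfl ?_
  simp only [kappa, zero_mul, zero_add]
  exact Int.emod_eq_of_lt e.idx_nonneg e.idx_lt

theorem phi_zero (e : Edge A) : phi B 0 e = 0 := by
  simp only [phi, zero_mul, zero_add]
  exact Int.ediv_eq_zero_of_lt e.idx_nonneg e.idx_lt

theorem kappa_neg_kappa (m : ℤ) (e : Edge A) : kappa B (-m) (kappa B m e) = e := by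
  rw [← kappa_add, neg_add_cancel, kappa_zero]

theorem phi_neg_kappa (m : ℤ) (e : Edge A) : phi B (-m) (kappa B m e) = -phi B m e := by
  have h := phi_add B (-m) m e
  rw [neg_add_cancel, phi_zero] at h
  omega

theorem PseudoFree.eq_of_eq {B : Matrix V V ℤ} (h : PseudoFree A B) {m m' : ℤ} {e : Edge A}
    (h1 : kappa B m e = kappa B m' e) (h2 : phi B m e = phi B m' e) : m = m' := by
  have h3 := h (m - m') (kappa B m' e) (by rw [← kappa_add, sub_add_cancel, h1]) (by
    have := phi_add B (m - m') m' e
    rw [sub_add_cancel, h2] at this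
    omega)
  omega

/-- The list `l` of edges is a path that starts at the vertex `v`. -/
def IsPath (v : V) : List (Edge A) → Prop
  | [] => True
  | e :: l => e.src = v ∧ IsPath e.rng l

/-- The vertex at which a path from `v` along the list `l` of edges ends. -/
def endpoint (v : V) : List (Edge A) → V
  | [] => v
  | e :: l => endpoint e.rng l

variable (A) in
/-- The finite paths, including the paths of length zero, which are the vertices. -/
@[ext]
structure FinPath where
  src : V
  edges : List (Edge A)
  isPath : IsPath src edges

variable (A) in
/-- The infinite path space, with the topology induced by the product of discrete spaces. -/
abbrev InfPath : Type u := {x : ℕ → Edge A // ∀ i, (x i).rng = (x (i + 1)).src}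

instance : TopologicalSpace (Edge A) := ⊥

instance : DiscreteTopology (Edge A) := ⟨rfl⟩

theorem isPath_append (v : V) (l l' : List (Edge A)) :
    IsPath v (l ++ l') ↔ IsPath v l ∧ IsPath (endpoint v l) l' := by
  induction l generalizing v with
  | nil => simp [IsPath, endpoint]
  | cons e l ih => simp [IsPath, endpoint, ih, and_assoc]

theorem endpoint_append (v : V) (l l' : List (Edge A)) :
    endpoint v (l ++ l') = endpoint (endpoint v l) l' := by
  induction l generalizing v with
  | nil => rfl
  | cons e l ih => exact ih _

namespace FinPath

/-- The range of a finite path. -/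
def rng (α : FinPath A) : V := endpoint α.src α.edges

/-- The length of a finite path. -/
def length (α : FinPath A) : ℕ := α.edges.length

/-- The path of length zero at a vertex. -/
def vertex (v : V) : FinPath A := ⟨v, [], trivial⟩

/-- The path `αe` for an edge `e` that starts where `α` ends. -/
def snoc (α : FinPath A) (e : Edge A) (h : e.src = α.rng) : FinPath A :=
  ⟨α.src, α.edges ++ [e], (isPath_append _ _ _).2 ⟨α.isPath, h, trivial⟩⟩

theorem rng_snoc (α : FinPath A) (e : Edge A) (h : e.src = α.rng) : (α.snoc e h).rng = e.rng :=
  endpoint_append _ _ _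

theorem length_snoc (α : FinPath A) (e : Edge A) (h : e.src = α.rng) :
    (α.snoc e h).length = α.length + 1 := by
  simp [length, snoc]

theorem snoc_inj {α α' : FinPath A} {e e' : Edge A} {h : e.src = α.rng} {h' : e'.src = α'.rng}
    (hs : α.snoc e h = α'.snoc e' h') : α = α' ∧ e = e' := by
  have h1 : α.src = α'.src := (congrArg FinPath.src hs :)
  have h2 : α.edges ++ [e] = α'.edges ++ [e'] := (congrArg FinPath.edges hs :)
  obtain ⟨h3, h4⟩ := List.append_inj' h2 rfl
  exact ⟨FinPath.ext h1 h3, by simpa using h4⟩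

end FinPath

/-- The sequence that starts with the list `l` and goes on with the sequence `y`. -/
def prepend : List (Edge A) → (ℕ → Edge A) → ℕ → Edge A
  | [], y => y
  | e :: l, y => fun n => Nat.casesOn n e (prepend l y)

theorem prepend_add (l : List (Edge A)) (y : ℕ → Edge A) (n : ℕ) :
    prepend l y (l.length + n) = y n := by
  induction l with
  | nil => simp [prepend]
  | cons e l ih => rw [List.length_cons, add_right_comm]; exact ih

theorem prepend_lt (l : List (Edge A)) (y : ℕ → Edge A) (n : ℕ) (h : n < l.length) :
    prepend l y n = l[n] := by
  induction l generalizing n with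
  | nil => simp at h
  | cons e l ih =>
    cases n with
    | zero => rfl
    | succ n => exact ih n (by simpa using h)

theorem prepend_snoc (l : List (Edge A)) (e : Edge A) (y : ℕ → Edge A) :
    prepend (l ++ [e]) y = prepend l (prepend [e] y) := by
  induction l with
  | nil => rfl
  | cons a l ih =>
    funext n
    cases n with
    | zero => rfl
    | succ n => exact congrFun ih n

theorem isPath_prepend_aux {v : V} {l : List (Edge A)} (hl : IsPath v l) {y : ℕ → Edge A}
    (hy : ∀ i, (y i).rng = (y (i + 1)).src) (h : (y 0).src = endpoint v l) :
    (prepend l y 0).src = v ∧ ∀ i, (prepend l y i).rng = (prepend l y (i + 1)).src := by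
  induction l generalizing v with
  | nil => exact ⟨h, hy⟩
  | cons e l ih =>
    obtain ⟨h1, h2⟩ := ih hl.2 h
    refine ⟨hl.1, fun i => ?_⟩
    cases i with
    | zero => exact h1.symm
    | succ i => exact h2 i

namespace InfPath

/-- The source of an infinite path. -/
def src (x : InfPath A) : V := (x.1 0).src

/-- The path obtained from `x` by deleting the first `n` edges. -/
def drop (n : ℕ) (x : InfPath A) : InfPath A :=
  ⟨fun i => x.1 (n + i), fun i => x.2 (n + i)⟩

end InfPath

/-- The concatenation `αy`. -/
def FinPath.append (α : FinPath A) (y : InfPath A) (h : y.src = α.rng) : InfPath A :=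
  ⟨prepend α.edges y.1, (isPath_prepend_aux α.isPath y.2 h).2⟩

theorem FinPath.src_append (α : FinPath A) (y : InfPath A) (h : y.src = α.rng) :
    (α.append y h).src = α.src := (isPath_prepend_aux α.isPath y.2 h).1

/-- The cylinder set `Z(α)` of the infinite paths that start with `α`. -/
def cylinder (α : FinPath A) : Set (InfPath A) :=
  {x | ∃ (y : InfPath A) (h : y.src = α.rng), x = α.append y h}

theorem FinPath.drop_append (α : FinPath A) (y : InfPath A) (h : y.src = α.rng) :
    (α.append y h).drop α.length = y :=
  Subtype.ext (funext fun n => prepend_add α.edges y.1 n)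

theorem src_drop_of_mem {α : FinPath A} {x : InfPath A} (hx : x ∈ cylinder α) :
    (x.drop α.length).src = α.rng := by
  obtain ⟨y, h, rfl⟩ := hx
  rw [α.drop_append, h]

theorem append_drop_of_mem {α : FinPath A} {x : InfPath A} (hx : x ∈ cylinder α) :
    α.append (x.drop α.length) (src_drop_of_mem hx) = x := by
  obtain ⟨y, h, rfl⟩ := hx
  simp only [α.drop_append]

theorem mem_cylinder_append (α : FinPath A) (y : InfPath A) (h : y.src = α.rng) :
    α.append y h ∈ cylinder α := ⟨y, h, rfl⟩

theorem cylinder_getElem {α : FinPath A} {x : InfPath A} (hx : x ∈ cylinder α) (n : ℕ)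
    (hn : n < α.edges.length) : α.edges[n] = x.1 n := by
  obtain ⟨y, h, rfl⟩ := hx
  exact (prepend_lt _ _ _ hn).symm

theorem cylinder_src {α : FinPath A} {x : InfPath A} (hx : x ∈ cylinder α) : x.src = α.src := by
  obtain ⟨y, h, rfl⟩ := hx
  exact α.src_append y h

/-- A finite path is determined by its length and an infinite path that extends it. -/
theorem eq_of_mem_cylinder {α α' : FinPath A} {x : InfPath A} (hx : x ∈ cylinder α)
    (hx' : x ∈ cylinder α') (h : α.length = α'.length) : α = α' := by
  refine FinPath.ext ((cylinder_src hx).symm.trans (cylinder_src hx')) ?_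
  refine List.ext_getElem h fun n h1 h2 => ?_
  rw [cylinder_getElem hx, cylinder_getElem hx']

theorem mem_cylinder_snoc {α : FinPath A} {x : InfPath A} (hx : x ∈ cylinder α)
    (h : (x.1 α.length).src = α.rng) : x ∈ cylinder (α.snoc (x.1 α.length) h) := by
  have h2 : (x.drop (α.length + 1)).src = (α.snoc (x.1 α.length) h).rng := by
    rw [α.rng_snoc]; exact (x.2 α.length).symm
  refine ⟨x.drop (α.length + 1), h2, ?_⟩
  conv_lhs => rw [← append_drop_of_mem hx]
  refine Subtype.ext ?_
  change prepend α.edges _ = prepend (α.edges ++ [x.1 α.length]) _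
  rw [prepend_snoc]
  congr 1
  funext n
  cases n with
  | zero => rfl
  | succ n => exact congrArg x.1 (by omega)

theorem mem_cylinder_of_snoc {α : FinPath A} {x : InfPath A} {e : Edge A} {h : e.src = α.rng}
    (hx : x ∈ cylinder (α.snoc e h)) : x ∈ cylinder α ∧ x.1 α.length = e := by
  obtain ⟨y, h', rfl⟩ := hx
  rw [α.rng_snoc] at h'
  have h1 : InfPath.src (A := A) ⟨prepend [e] y.1,
      (isPath_prepend_aux (v := α.rng) (l := [e]) ⟨h, trivial⟩ y.2 h').2⟩ = α.rng := h
  have h2 : α.append _ h1 = (α.snoc e h).append y (by rw [α.rng_snoc]; exact h') :=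
    Subtype.ext (prepend_snoc α.edges e y.1).symm
  rw [← h2]
  exact ⟨mem_cylinder_append _ _ _, prepend_add α.edges _ 0⟩

theorem isOpen_agree (x : InfPath A) (n : ℕ) : IsOpen {z : InfPath A | ∀ i < n, z.1 i = x.1 i} := by
  have h : {z : InfPath A | ∀ i < n, z.1 i = x.1 i} =
      ⋂ i ∈ Finset.range n, (fun z : InfPath A => z.1 i) ⁻¹' {x.1 i} := by
    ext z
    simp
  rw [h]
  exact isOpen_biInter_finset fun i _ =>
    (isOpen_discrete _).preimage ((continuous_apply i).comp continuous_subtype_val)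

theorem exists_agree_subset {W : Set (InfPath A)} (hW : IsOpen W) {x : InfPath A} (hx : x ∈ W) :
    ∃ n, ∀ z : InfPath A, (∀ i < n, z.1 i = x.1 i) → z ∈ W := by
  obtain ⟨O, hO, rfl⟩ := isOpen_induced_iff.1 hW
  obtain ⟨I, u, hu, hIu⟩ := isOpen_pi_iff.1 hO x.1 hx
  refine ⟨I.sup id + 1, fun z hz => hIu fun i hi => ?_⟩
  have : i ≤ I.sup id := Finset.le_sup (f := id) hi
  rw [hz i (by omega)]
  exact (hu i hi).2

theorem isOpen_cylinder (α : FinPath A) : IsOpen (cylinder α) := by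
  refine isOpen_iff_forall_mem_open.2 fun x hx =>
    ⟨_, fun z hz => ?_, isOpen_agree x (α.length + 1), fun i _ => rfl⟩
  have h : (z.drop α.length).src = α.rng := by
    rw [← src_drop_of_mem hx]
    exact congrArg Edge.src (hz α.length (by omega))
  refine ⟨z.drop α.length, h, Subtype.ext (funext fun n => ?_)⟩
  change _ = prepend α.edges _ n
  rcases lt_or_ge n α.edges.length with hn | hn
  · rw [prepend_lt _ _ _ hn, cylinder_getElem hx]
    exact hz n (Nat.lt_succ_of_lt hn)
  · obtain ⟨k, rfl⟩ := Nat.exists_eq_add_of_le hn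
    rw [prepend_add]
    rfl

theorem agree_of_mem_cylinder {α : FinPath A} {x z : InfPath A} (hx : x ∈ cylinder α)
    (hz : z ∈ cylinder α) (i : ℕ) (hi : i < α.length) : z.1 i = x.1 i := by
  rw [← cylinder_getElem hx i hi, ← cylinder_getElem hz i hi]

/-- Along an infinite path `y` the cocycle takes the values `φ (m, y_1 ⋯ y_n)`. -/
def phiSeq (m : ℤ) (y : ℕ → Edge A) : ℕ → ℤ
  | 0 => m
  | n + 1 => phi B (phiSeq m y n) (y n)

/-- The action of `m : ℤ` on infinite paths,
`κ_m (y_1 y_2 ⋯) = κ_m (y_1) κ_{φ (m, y_1)} (y_2) κ_{φ (m, y_1 y_2)} (y_3) ⋯`. -/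
def act (m : ℤ) (y : InfPath A) : InfPath A :=
  ⟨fun n => kappa B (phiSeq B m y.1 n) (y.1 n), fun i => y.2 i⟩

theorem phiSeq_add (m₁ m₂ : ℤ) (y : InfPath A) (n : ℕ) :
    phiSeq B (m₁ + m₂) y.1 n = phiSeq B m₁ (act B m₂ y).1 n + phiSeq B m₂ y.1 n := by
  induction n with
  | zero => rfl
  | succ n ih => rw [phiSeq, ih, phi_add]; rfl

theorem act_add (m₁ m₂ : ℤ) (y : InfPath A) : act B (m₁ + m₂) y = act B m₁ (act B m₂ y) := by
  refine Subtype.ext (funext fun n => ?_)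
  change kappa B (phiSeq B (m₁ + m₂) y.1 n) (y.1 n) = _
  rw [phiSeq_add, kappa_add]
  rfl

theorem act_zero (y : InfPath A) : act B 0 y = y := by
  have h : ∀ n, phiSeq B 0 y.1 n = 0 := by
    intro n
    induction n with
    | zero => rfl
    | succ n ih => rw [phiSeq, ih, phi_zero]
  refine Subtype.ext (funext fun n => ?_)
  change kappa B (phiSeq B 0 y.1 n) (y.1 n) = y.1 n
  rw [h, kappa_zero]

theorem phiSeq_succ' (m : ℤ) (y : ℕ → Edge A) (n : ℕ) :
    phiSeq B m y (n + 1) = phiSeq B (phi B m (y 0)) (fun i => y (1 + i)) n := by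
  induction n with
  | zero => rfl
  | succ n ih =>
    rw [phiSeq, ih, phiSeq, add_comm 1 n]

variable (A) in
/-- The quadruples `(α, m, β; x)` with `r(α) = r(β)` and `x ∈ Z(β)`. -/
@[ext]
structure Quad where
  α : FinPath A
  m : ℤ
  β : FinPath A
  x : InfPath A
  rng_eq : α.rng = β.rng
  mem : x ∈ cylinder β

/-- The generating relation `(α, m, β; x) ∼ (α κ_m(γ), φ(m, γ), βγ; x)`, where `x = βγy`. -/
def Step (q q' : Quad A) : Prop :=
  ∃ (γ : Edge A) (h : γ.src = q.β.rng),
    q'.α = q.α.snoc (kappa B q.m γ) (h.trans q.rng_eq.symm) ∧ q'.m = phi B q.m γ ∧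
      q'.β = q.β.snoc γ h ∧ q'.x = q.x

variable (A) in
/-- The arrows of the Katsura–Exel–Pardo groupoid: the classes `[α, m, β; x]` for the equivalence
relation generated by `Step`. -/
def Arrow : Type u := Quot (Step (A := A) B)

/-- The class `[α, m, β; x]`. -/
def mk (q : Quad A) : Arrow A B := Quot.mk _ q

namespace Quad

/-- The range `α κ_m(y)` of `(α, m, β; x)`, where `x = βy`. -/
def rng (q : Quad A) : InfPath A :=
  q.α.append (act B q.m (q.x.drop q.β.length)) ((src_drop_of_mem q.mem).trans q.rng_eq.symm)

theorem rng_mem (q : Quad A) : q.rng B ∈ cylinder q.α := mem_cylinder_append _ _ _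

theorem src_next (q : Quad A) : (q.x.1 q.β.length).src = q.β.rng := src_drop_of_mem q.mem

/-- The quadruple that represents the same class with `β` longer by one edge. -/
def next (q : Quad A) : Quad A where
  α := q.α.snoc (kappa B q.m (q.x.1 q.β.length)) (q.src_next.trans q.rng_eq.symm)
  m := phi B q.m (q.x.1 q.β.length)
  β := q.β.snoc (q.x.1 q.β.length) q.src_next
  x := q.x
  rng_eq := 
    (FinPath.rng_snoc _ _ _).trans (FinPath.rng_snoc _ (q.x.1 q.β.length) q.src_next).symm
  mem := mem_cylinder_snoc q.mem q.src_next

theorem next_length_α (q : Quad A) : (q.next B).α.length = q.α.length + 1 :=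
  FinPath.length_snoc q.α (kappa B q.m (q.x.1 q.β.length)) (q.src_next.trans q.rng_eq.symm)

theorem next_length_β (q : Quad A) : (q.next B).β.length = q.β.length + 1 :=
  FinPath.length_snoc _ _ q.src_next

end Quad

theorem step_iff (q q' : Quad A) : Step B q q' ↔ q' = q.next B := by
  constructor
  · rintro ⟨γ, h, h1, h2, h3, h4⟩
    have h5 : q'.x ∈ cylinder (q.β.snoc γ h) := h3 ▸ q'.mem
    rw [h4] at h5
    obtain rfl := (mem_cylinder_of_snoc h5).2
    exact Quad.ext h1 h2 h3 h4
  · rintro rfl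
    exact ⟨_, q.src_next, rfl, rfl, rfl, rfl⟩

theorem mk_next (q : Quad A) : mk B (q.next B) = mk B q :=
  (Quot.sound ((step_iff B q _).2 rfl)).symm

theorem mk_iterate_next (q : Quad A) (n : ℕ) : mk B ((Quad.next B)^[n] q) = mk B q := by
  induction n with
  | zero => rfl
  | succ n ih => rw [Function.iterate_succ_apply', mk_next, ih]

theorem mk_eq_iff (q q' : Quad A) :
    mk B q = mk B q' ↔ ∃ a b, (Quad.next B)^[a] q = (Quad.next B)^[b] q' := by
  constructor
  · intro h
    have h' := Quot.eqvGen_exact h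
    clear h
    induction h' with
    | rel q q' h => exact ⟨1, 0, ((step_iff B q q').1 h).symm⟩
    | refl q => exact ⟨0, 0, rfl⟩
    | symm q q' h ih =>
      obtain ⟨a, b, hab⟩ := ih
      exact ⟨b, a, hab.symm⟩
    | trans q q' q'' h h' ih ih' =>
      obtain ⟨a, b, hab⟩ := ih
      obtain ⟨c, d, hcd⟩ := ih'
      refine ⟨c + a, b + d, ?_⟩
      rw [Function.iterate_add_apply, hab, ← Function.iterate_add_apply, add_comm c b,
        Function.iterate_add_apply, hcd, ← Function.iterate_add_apply]
  · rintro ⟨a, b, h⟩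
    rw [← mk_iterate_next B q a, h, mk_iterate_next]

namespace Quad

theorem iterate_x (q : Quad A) (n : ℕ) : ((next B)^[n] q).x = q.x := by
  induction n with
  | zero => rfl
  | succ n ih => rw [Function.iterate_succ_apply']; exact ih

theorem iterate_length_β (q : Quad A) (n : ℕ) :
    ((next B)^[n] q).β.length = q.β.length + n := by
  induction n with
  | zero => rfl
  | succ n ih =>
    rw [Function.iterate_succ_apply', next_length_β, ih, add_assoc]

theorem iterate_length_α (q : Quad A) (n : ℕ) :
    ((next B)^[n] q).α.length = q.α.length + n := by
  induction n with
  | zero => rfl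
  | succ n ih =>
    rw [Function.iterate_succ_apply', next_length_α, ih, add_assoc]

theorem rng_next (q : Quad A) : (q.next B).rng B = q.rng B := by
  refine Subtype.ext ?_
  change prepend (q.α.edges ++ [kappa B q.m (q.x.1 q.β.length)]) _ = prepend q.α.edges _
  rw [prepend_snoc]
  congr 1
  funext n
  cases n with
  | zero => rfl
  | succ n =>
    change kappa B (phiSeq B (phi B q.m (q.x.1 q.β.length)) _ n) _ =
      kappa B (phiSeq B q.m _ (n + 1)) _
    rw [phiSeq_succ']
    simp only [InfPath.drop, next, FinPath.length_snoc, add_assoc, add_comm 1, add_zero]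

theorem iterate_rng (q : Quad A) (n : ℕ) : ((next B)^[n] q).rng B = q.rng B := by
  induction n with
  | zero => rfl
  | succ n ih => rw [Function.iterate_succ_apply', rng_next, ih]

theorem rng_at (q : Quad A) : (q.rng B).1 q.α.length = kappa B q.m (q.x.1 q.β.length) :=
  prepend_add q.α.edges _ 0

theorem next_injective {B : Matrix V V ℤ} (h : PseudoFree A B) :
    Function.Injective (next (A := A) B) := by
  intro q q' hq
  have hx : q.x = q'.x := (congrArg Quad.x hq :)
  obtain ⟨h1, h2⟩ := FinPath.snoc_inj (e := kappa B q.m (q.x.1 q.β.length))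
    (e' := kappa B q'.m (q'.x.1 q'.β.length)) (h := q.src_next.trans q.rng_eq.symm)
    (h' := q'.src_next.trans q'.rng_eq.symm) (congrArg Quad.α hq)
  obtain ⟨h3, h4⟩ := FinPath.snoc_inj (h := q.src_next) (h' := q'.src_next) (congrArg Quad.β hq)
  have h5 : phi B q.m (q.x.1 q.β.length) = phi B q'.m (q'.x.1 q'.β.length) :=
    (congrArg Quad.m hq :)
  rw [← h4] at h2 h5
  exact Quad.ext h1 (h.eq_of_eq h2 h5) h3 hx

/-- The unit quadruple `(v, 0, v; x)`, where `v` is the source of `x`. -/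
def unit (x : InfPath A) : Quad A where
  α := .vertex x.src
  m := 0
  β := .vertex x.src
  x := x
  rng_eq := rfl
  mem := ⟨x, rfl, rfl⟩

/-- The inverse quadruple `(β, -m, α; α κ_m(y))`, where `x = βy`. -/
def inv (q : Quad A) : Quad A where
  α := q.β
  m := -q.m
  β := q.α
  x := q.rng B
  rng_eq := q.rng_eq.symm
  mem := q.rng_mem B

/-- The product `(α, m' + m, γ; γx)` of `(α, m', β; β κ_m(x))` and `(β, m, γ; γx)`. -/
def comp (q q' : Quad A) (h : q.β = q'.α) : Quad A where
  α := q.α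
  m := q.m + q'.m
  β := q'.β
  x := q'.x
  rng_eq := by rw [q.rng_eq, h, q'.rng_eq]
  mem := q'.mem

/-- The quadruples `q` and `q'` have the form `(α, m', β; β κ_m(x))` and `(β, m, γ; γx)`. -/
structure Matched (q q' : Quad A) : Prop where
  β_eq : q.β = q'.α
  x_eq : q.x = q'.rng B

end Quad

namespace Quad

theorem eq_of_length {q q' : Quad A} (hx : q.x = q'.x) (hr : q.rng B = q'.rng B) (hm : q.m = q'.m)
    (hα : q.α.length = q'.α.length) (hβ : q.β.length = q'.β.length) : q = q' :=
  Quad.ext (eq_of_mem_cylinder (q.rng_mem B) (hr ▸ q'.rng_mem B) hα) hm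
    (eq_of_mem_cylinder q.mem (hx ▸ q'.mem) hβ) hx

theorem rng_unit (x : InfPath A) : (unit x).rng B = x := by
  have h0 : x.drop 0 = x := Subtype.ext (funext fun n => congrArg x.1 (zero_add n))
  refine Subtype.ext ?_
  change (act B 0 (x.drop 0)).1 = x.1
  rw [h0, act_zero]

theorem iterate_unit (x : InfPath A) (n : ℕ) :
    ((next B)^[n] (unit x)).m = 0 ∧ ((next B)^[n] (unit x)).α = ((next B)^[n] (unit x)).β := by
  induction n with
  | zero => exact ⟨rfl, rfl⟩
  | succ n ih =>
    rw [Function.iterate_succ_apply']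
    set q := (next B)^[n] (unit x)
    obtain ⟨h1, h2⟩ := ih
    refine ⟨?_, FinPath.ext ?_ ?_⟩
    · simp only [next, h1, phi_zero]
    · exact (congrArg FinPath.src h2 :)
    · simp only [next, FinPath.snoc, h1, kappa_zero, h2]

theorem rng_inv (q : Quad A) : (q.inv B).rng B = q.x := by
  refine Subtype.ext ?_
  have h1 := append_drop_of_mem q.mem
  have h2 : (q.rng B).drop q.α.length = act B q.m (q.x.drop q.β.length) :=
    FinPath.drop_append _ _ _
  have h3 := congrArg Subtype.val h1
  rw [← h3]
  change prepend q.β.edges (act B (-q.m) ((q.rng B).drop q.α.length)).1 = _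
  rw [h2, ← act_add, neg_add_cancel, act_zero]
  rfl

theorem inv_next (q : Quad A) : (q.next B).inv B = (q.inv B).next B := by
  have h : (q.inv B).x.1 (q.inv B).β.length = kappa B q.m (q.x.1 q.β.length) := q.rng_at B
  refine Quad.ext ?_ ?_ ?_ (rng_next B q)
  · refine FinPath.ext rfl ?_
    simp only [inv, next, FinPath.snoc, rng_at, kappa_neg_kappa]
  · simp only [inv, next, rng_at, phi_neg_kappa]
  · refine FinPath.ext rfl ?_
    simp only [inv, next, FinPath.snoc, rng_at]

theorem Matched.next {q q' : Quad A} (h : q.Matched B q') :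
    (q.next B).Matched B (q'.next B) := by
  have h1 : q.x.1 q.β.length = kappa B q'.m (q'.x.1 q'.β.length) := by
    rw [h.1, h.2, rng_at]
  refine ⟨FinPath.ext (congrArg FinPath.src h.1 :) ?_, ?_⟩
  · simp only [Quad.next, FinPath.snoc, h1]
    rw [h.1]
  · rw [rng_next]
    exact h.2

theorem comp_next {q q' : Quad A} (h : q.Matched B q') :
    (q.comp q' h.1).next B = (q.next B).comp (q'.next B) h.next.1 := by
  have h1 : q.x.1 q.β.length = kappa B q'.m (q'.x.1 q'.β.length) := by
    rw [h.1, h.2, rng_at]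
  refine Quad.ext (FinPath.ext rfl ?_) ?_ rfl rfl
  · simp only [Quad.next, FinPath.snoc, comp, h1, kappa_add]
  · simp only [Quad.next, comp, h1, phi_add]

theorem Matched.iterate {q q' : Quad A} (h : q.Matched B q') (n : ℕ) :
    ((Quad.next B)^[n] q).Matched B ((Quad.next B)^[n] q') := by
  induction n with
  | zero => exact h
  | succ n ih =>
    rw [Function.iterate_succ_apply', Function.iterate_succ_apply']
    exact ih.next

theorem comp_iterate {q q' : Quad A} (h : q.Matched B q') (n : ℕ) :
    (Quad.next B)^[n] (q.comp q' h.1) =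
      ((Quad.next B)^[n] q).comp ((Quad.next B)^[n] q') (h.iterate B n).1 := by
  induction n with
  | zero => rfl
  | succ n ih =>
    rw [Function.iterate_succ_apply', ih, comp_next B (h.iterate B n)]
    simp only [Function.iterate_succ_apply']

theorem comp_congr {p p' q q' : Quad A} (hp : p = p') (hq : q = q') (h : p.β = q.α)
    (h' : p'.β = q'.α) : p.comp q h = p'.comp q' h' := by
  subst hp hq
  rfl

theorem exists_matched {q q' : Quad A} (h : q.x = q'.rng B) :
    ((next B)^[q'.α.length] q).Matched B ((next B)^[q.β.length] q') := by
  have hr : ((next B)^[q'.α.length] q).x = ((next B)^[q.β.length] q').rng B := by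
    rw [iterate_x, iterate_rng, h]
  refine ⟨eq_of_mem_cylinder (mem _) (hr ▸ rng_mem B _) ?_, hr⟩
  rw [iterate_length_α, iterate_length_β, add_comm]

end Quad

theorem mk_comp_eq {p p' q q' : Quad A} (h : p.Matched B q) (h' : p'.Matched B q')
    (hp : mk B p = mk B p') (hq : mk B q = mk B q') :
    mk B (p.comp q h.1) = mk B (p'.comp q' h'.1) := by
  obtain ⟨a, a', ha⟩ := (mk_eq_iff B p p').1 hp
  obtain ⟨b, b', hb⟩ := (mk_eq_iff B q q').1 hq
  have h1 := congrArg (fun r => r.β.length) ha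
  have h2 := congrArg (fun r => r.α.length) hb
  simp only [Quad.iterate_length_α, Quad.iterate_length_β] at h1 h2
  rw [h.1, h'.1] at h1
  have h3 : b + a' = a + b' := by omega
  refine (mk_eq_iff B _ _).2 ⟨b + a, b + a', ?_⟩
  rw [Quad.comp_iterate B h, Quad.comp_iterate B h']
  refine Quad.comp_congr ?_ ?_ _ _
  · rw [Function.iterate_add_apply, ha, ← Function.iterate_add_apply]
  · rw [h3, add_comm b a, Function.iterate_add_apply, hb, ← Function.iterate_add_apply]


namespace Arrow

variable {B}

/-- The source `s [α, m, β; x] = x`. -/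
def src : Arrow A B → InfPath A :=
  Quot.lift Quad.x fun q q' h => by rw [(step_iff B q q').1 h]; rfl

/-- The range `r [α, m, β; βy] = α κ_m(y)`. -/
def rng : Arrow A B → InfPath A :=
  Quot.lift (Quad.rng B) fun q q' h => by rw [(step_iff B q q').1 h, Quad.rng_next]

/-- The inverse `[α, m, β; βy]⁻¹ = [β, -m, α; α κ_m(y)]`. -/
def inv : Arrow A B → Arrow A B :=
  Quot.lift (fun q => mk B (q.inv B)) fun q q' h => by
    rw [(step_iff B q q').1 h, Quad.inv_next, mk_next]

/-- The unit `[v, 0, v; x]` at `x`, where `v` is the source of `x`. -/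
def one (x : InfPath A) : Arrow A B := mk B (Quad.unit x)

/-- The relation `k = g h` given by the formula
`[α, m', β; β κ_m(x)] [β, m, γ; γx] = [α, m' + m, γ; γx]`. -/
def IsMul (g h k : Arrow A B) : Prop :=
  ∃ (p q : Quad A) (hpq : p.Matched B q), mk B p = g ∧ mk B q = h ∧ mk B (p.comp q hpq.1) = k

theorem exists_isMul (g h : Arrow A B) (hgh : g.src = h.rng) : ∃ k, IsMul g h k := by
  induction g using Quot.ind with | mk p => ?_
  induction h using Quot.ind with | mk q => ?_
  exact ⟨_, _, _, Quad.exists_matched B hgh, mk_iterate_next B p _, mk_iterate_next B q _, rfl⟩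

open scoped Classical in
/-- The product `g h` of two arrows with `s(g) = r(h)`; the value on other pairs is irrelevant. -/
noncomputable def mul (g h : Arrow A B) : Arrow A B :=
  if hgh : g.src = h.rng then (exists_isMul g h hgh).choose else g

theorem mul_mk {p q : Quad A} (h : p.Matched B q) :
    mul (mk B p) (mk B q) = mk B (p.comp q h.1) := by
  have h' : (mk B p).src = (mk B q).rng := h.2
  rw [mul, dif_pos h']
  obtain ⟨p', q', hpq, h1, h2, h3⟩ := (exists_isMul _ _ h').choose_spec
  rw [← h3]
  exact mk_comp_eq B hpq h h1 h2

theorem exists_rep (g h : Arrow A B) (hgh : g.src = h.rng) :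
    ∃ p q : Quad A, p.Matched B q ∧ mk B p = g ∧ mk B q = h := by
  obtain ⟨_, p, q, h1, h2, h3, -⟩ := exists_isMul g h hgh
  exact ⟨p, q, h1, h2, h3⟩

theorem rng_comp {p q : Quad A} (h : p.Matched B q) : (p.comp q h.1).rng B = p.rng B := by
  refine Subtype.ext ?_
  change prepend p.α.edges (act B (p.m + q.m) (q.x.drop q.β.length)).1 =
    prepend p.α.edges (act B p.m (p.x.drop p.β.length)).1
  have h1 : (q.rng B).drop q.α.length = act B q.m (q.x.drop q.β.length) :=
    FinPath.drop_append _ _ _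
  rw [h.1, h.2, h1, act_add]

theorem src_mul (g h : Arrow A B) (hgh : g.src = h.rng) : (mul g h).src = h.src := by
  obtain ⟨p, q, hpq, rfl, rfl⟩ := exists_rep g h hgh
  rw [mul_mk hpq]
  rfl

theorem rng_mul (g h : Arrow A B) (hgh : g.src = h.rng) : (mul g h).rng = g.rng := by
  obtain ⟨p, q, hpq, rfl, rfl⟩ := exists_rep g h hgh
  rw [mul_mk hpq]
  exact rng_comp hpq

theorem mul_assoc (g h k : Arrow A B) (hgh : g.src = h.rng) (hhk : h.src = k.rng) :
    mul (mul g h) k = mul g (mul h k) := by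
  obtain ⟨p, q, hpq, hp, hq⟩ := exists_rep g h hgh
  obtain ⟨q', r, hqr, hq', hr⟩ := exists_rep h k hhk
  obtain ⟨a, b, hab⟩ := (mk_eq_iff B q q').1 (hq.trans hq'.symm)
  have h1 := hpq.iterate B a
  have h2 := hqr.iterate B b
  rw [← mk_iterate_next B p a] at hp
  rw [← mk_iterate_next B q a, hab] at hq
  rw [← mk_iterate_next B r b] at hr
  rw [hab] at h1
  subst hp hq hr
  rw [mul_mk h1, mul_mk h2,
    mul_mk (p := ((Quad.next B)^[a] p).comp _ h1.1) (q := (Quad.next B)^[b] r) ⟨h2.1, h2.2⟩,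
    mul_mk (p := (Quad.next B)^[a] p) (q := ((Quad.next B)^[b] q').comp _ h2.1)
      ⟨h1.1, h1.2.trans (rng_comp h2).symm⟩]
  congr 1
  exact Quad.ext rfl (_root_.add_assoc _ _ _) rfl rfl

theorem mk_eq_one {q : Quad A} (h : q.α = q.β) (hm : q.m = 0) : mk B q = one q.x := by
  have h1 := Quad.iterate_unit B q.x q.β.length
  have h2 : (Quad.next B)^[q.β.length] (Quad.unit q.x) = q := by
    have h3 : ((Quad.next B)^[q.β.length] (Quad.unit q.x)).β = q.β := by
      refine eq_of_mem_cylinder (Quad.mem _) ?_ ?_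
      · rw [Quad.iterate_x]; exact q.mem
      · rw [Quad.iterate_length_β]; exact zero_add _
    refine Quad.ext (h1.2.trans (h3.trans h.symm)) (h1.1.trans hm.symm) h3 ?_
    rw [Quad.iterate_x]
    rfl
  rw [one, ← mk_iterate_next B (Quad.unit q.x) q.β.length, h2]

theorem inv_mul (g : Arrow A B) : mul (inv g) g = one g.src := by
  induction g using Quot.ind with | mk q => ?_
  have h : (q.inv B).Matched B q := ⟨rfl, rfl⟩
  refine (mul_mk h).trans ?_
  exact mk_eq_one (q := (q.inv B).comp q h.1) rfl (neg_add_cancel q.m)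

theorem inv_inv (g : Arrow A B) : inv (inv g) = g := by
  induction g using Quot.ind with | mk q => ?_
  refine congrArg (mk B) (Quad.ext rfl (neg_neg q.m) rfl (Quad.rng_inv B q))

theorem src_inv (g : Arrow A B) : (inv g).src = g.rng := by
  induction g using Quot.ind with | mk q => rfl

theorem rng_inv (g : Arrow A B) : (inv g).rng = g.src := by
  rw [← src_inv, inv_inv]

theorem mul_inv (g : Arrow A B) : mul g (inv g) = one g.rng := by
  have h := inv_mul (inv g)
  rwa [inv_inv, src_inv] at h

theorem src_one (x : InfPath A) : (one x : Arrow A B).src = x := rfl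

theorem rng_one (x : InfPath A) : (one x : Arrow A B).rng = x := Quad.rng_unit B x

theorem one_mul (g : Arrow A B) : mul (one g.rng) g = g := by
  induction g using Quot.ind with | mk q => ?_
  let p : Quad A := ⟨q.α, 0, q.α, q.rng B, rfl, q.rng_mem B⟩
  have h : p.Matched B q := ⟨rfl, rfl⟩
  have h1 : mk B p = one (q.rng B) := mk_eq_one (q := p) rfl rfl
  have h2 := mul_mk h
  rw [h1] at h2
  exact h2.trans (congrArg (mk B) (Quad.ext rfl (zero_add _) rfl rfl))

theorem mul_one (g : Arrow A B) : mul g (one g.src) = g := by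
  rw [← inv_mul, ← mul_assoc g (inv g) g (rng_inv g).symm (src_inv g), mul_inv, one_mul]

/-- The degree `[α, m, β; x] ↦ |α| - |β|`. -/
def degree : Arrow A B → ℤ :=
  Quot.lift (fun q => (q.α.length : ℤ) - q.β.length) fun q q' h => by
    rw [(step_iff B q q').1 h]
    simp only [Quad.next_length_α, Quad.next_length_β]
    omega

theorem degree_mul (g h : Arrow A B) (hgh : g.src = h.rng) :
    (mul g h).degree = g.degree + h.degree := by
  obtain ⟨p, q, hpq, rfl, rfl⟩ := exists_rep g h hgh
  rw [mul_mk hpq]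
  change (p.α.length : ℤ) - q.β.length =
    (p.α.length - p.β.length) + (q.α.length - q.β.length)
  rw [hpq.1]
  omega

/-- The set `Z(α, m, β; Z(β))` of the classes `[α, m, β; x]` with `x ∈ Z(β)`. -/
def cyl (α : FinPath A) (m : ℤ) (β : FinPath A) : Set (Arrow A B) :=
  {g | ∃ q : Quad A, q.α = α ∧ q.m = m ∧ q.β = β ∧ mk B q = g}

/-- The topology with the sets `Z(α, m, β; Z(β))` as a basis. -/
instance : TopologicalSpace (Arrow A B) :=
  .generateFrom {s | ∃ α m β, s = cyl α m β}

/-- The set `Z(α, m, β; Z(β))` given by the entries of a quadruple. -/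
def nbhd (B : Matrix V V ℤ) (q : Quad A) : Set (Arrow A B) := cyl q.α q.m q.β

theorem isOpen_nbhd (q : Quad A) : IsOpen (nbhd B q) :=
  TopologicalSpace.isOpen_generateFrom_of_mem ⟨_, _, _, rfl⟩

theorem mem_nbhd (q : Quad A) : mk B q ∈ nbhd B q := ⟨q, rfl, rfl, rfl, rfl⟩

theorem nbhd_next (q : Quad A) : nbhd B (q.next B) ⊆ nbhd B q := by
  rintro _ ⟨p, h1, h2, h3, rfl⟩
  have h4 := mem_cylinder_of_snoc (h := q.src_next) (h3 ▸ p.mem : p.x ∈ cylinder (q.next B).β)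
  let p' : Quad A := ⟨q.α, q.m, q.β, p.x, q.rng_eq, h4.1⟩
  refine ⟨p', rfl, rfl, rfl, ?_⟩
  rw [← mk_next]
  congr 1
  refine Quad.ext ?_ ?_ ?_ rfl
  · rw [h1]; simp only [Quad.next, p', h4.2]
  · rw [h2]; simp only [Quad.next, p', h4.2]
  · rw [h3]; simp only [Quad.next, p', h4.2]

theorem nbhd_iterate_anti (q : Quad A) {a b : ℕ} (h : a ≤ b) :
    nbhd B ((Quad.next B)^[b] q) ⊆ nbhd B ((Quad.next B)^[a] q) := by
  induction h with
  | refl => exact subset_rfl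
  | step _ ih => rw [Function.iterate_succ_apply']; exact (nbhd_next _).trans ih

theorem exists_nbhd_subset {U : Set (Arrow A B)} (hU : IsOpen U) {q : Quad A} (hq : mk B q ∈ U) :
    ∃ a, nbhd B ((Quad.next B)^[a] q) ⊆ U := by
  induction hU with
  | basic s hs =>
    obtain ⟨α, m, β, rfl⟩ := hs
    obtain ⟨p, rfl, rfl, rfl, h⟩ := hq
    obtain ⟨a, b, hab⟩ := (mk_eq_iff B p q).1 h
    exact ⟨b, hab ▸ nbhd_iterate_anti p (Nat.zero_le a)⟩
  | univ => exact ⟨0, Set.subset_univ _⟩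
  | inter s t _ _ ihs iht =>
    obtain ⟨a, ha⟩ := ihs hq.1
    obtain ⟨b, hb⟩ := iht hq.2
    exact ⟨max a b, Set.subset_inter ((nbhd_iterate_anti q (le_max_left a b)).trans ha)
      ((nbhd_iterate_anti q (le_max_right a b)).trans hb)⟩
  | sUnion S _ ih =>
    obtain ⟨s, hs, hqs⟩ := hq
    obtain ⟨a, ha⟩ := ih s hs hqs
    exact ⟨a, ha.trans (Set.subset_sUnion_of_mem hs)⟩

theorem continuous_src : Continuous (src : Arrow A B → InfPath A) := by
  refine ⟨fun W hW => isOpen_iff_forall_mem_open.2 fun g hg => ?_⟩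
  induction g using Quot.ind with | mk q => ?_
  obtain ⟨n, hn⟩ := exists_agree_subset hW hg
  refine ⟨_, ?_, isOpen_nbhd ((Quad.next B)^[n] q), ?_⟩
  · rintro _ ⟨p, -, -, h3, rfl⟩
    refine hn p.x fun i hi => ?_
    refine agree_of_mem_cylinder (α := p.β) ?_ p.mem i ?_
    · have := ((Quad.next B)^[n] q).mem
      rw [← h3, Quad.iterate_x] at this
      exact this
    · rw [h3, Quad.iterate_length_β]
      omega
  · have := mem_nbhd (B := B) ((Quad.next B)^[n] q)
    rwa [mk_iterate_next] at this

theorem isOpenMap_src : IsOpenMap (src : Arrow A B → InfPath A) := by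
  intro U hU
  refine isOpen_iff_forall_mem_open.2 ?_
  rintro _ ⟨g, hg, rfl⟩
  induction g using Quot.ind with | mk q => ?_
  obtain ⟨a, ha⟩ := exists_nbhd_subset hU hg
  set p := (Quad.next B)^[a] q with hp
  refine ⟨cylinder p.β, fun x hx => ?_, isOpen_cylinder _, ?_⟩
  · exact ⟨mk B ⟨p.α, p.m, p.β, x, p.rng_eq, hx⟩,
      ha ⟨⟨p.α, p.m, p.β, x, p.rng_eq, hx⟩, rfl, rfl, rfl, rfl⟩, rfl⟩
  · have : p.x = q.x := Quad.iterate_x B q a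
    change q.x ∈ _
    rw [← this]
    exact p.mem

theorem isLocalHomeomorph_src : IsLocalHomeomorph (src : Arrow A B → InfPath A) := by
  refine isLocalHomeomorph_of_locallyInjective_of_isOpenMap continuous_src isOpenMap_src fun g => ?_
  induction g using Quot.ind with | mk q => ?_
  refine ⟨nbhd B q, isOpen_nbhd q, mem_nbhd q, ?_⟩
  rintro _ ⟨p, h1, h2, h3, rfl⟩ _ ⟨p', h1', h2', h3', rfl⟩ h
  rw [Quad.ext (h1.trans h1'.symm) (h2.trans h2'.symm) (h3.trans h3'.symm) h]

theorem continuous_inv : Continuous (inv : Arrow A B → Arrow A B) := by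
  refine continuous_generateFrom_iff.2 ?_
  rintro _ ⟨α, m, β, rfl⟩
  have h : inv ⁻¹' (cyl α m β : Set (Arrow A B)) = cyl β (-m) α := by
    ext g
    constructor
    · rintro ⟨q, rfl, rfl, rfl, h⟩
      exact ⟨q.inv B, rfl, rfl, rfl, by rw [← inv_inv g, ← h]; rfl⟩
    · rintro ⟨q, rfl, h, rfl, rfl⟩
      exact ⟨q.inv B, rfl, by rw [← neg_neg m, ← h]; rfl, rfl, rfl⟩
  rw [h]
  exact TopologicalSpace.isOpen_generateFrom_of_mem ⟨_, _, _, rfl⟩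

theorem isLocalHomeomorph_rng : IsLocalHomeomorph (rng : Arrow A B → InfPath A) := by
  have h : (rng : Arrow A B → InfPath A) = src ∘ inv := funext fun g => (src_inv g).symm
  let e : Arrow A B ≃ₜ Arrow A B := ⟨⟨inv, inv, inv_inv, inv_inv⟩, continuous_inv, continuous_inv⟩
  rw [h]
  exact isLocalHomeomorph_src.comp e.isLocalHomeomorph

theorem continuous_one : Continuous (one : InfPath A → Arrow A B) := by
  refine ⟨fun U hU => isOpen_iff_forall_mem_open.2 fun x hx => ?_⟩
  obtain ⟨a, ha⟩ := exists_nbhd_subset hU hx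
  set p := (Quad.next B)^[a] (Quad.unit x) with hp
  have h := Quad.iterate_unit B x a
  rw [← hp] at h
  refine ⟨cylinder p.β, fun z hz => ha ?_, isOpen_cylinder _, ?_⟩
  · exact ⟨⟨p.β, 0, p.β, z, rfl, hz⟩, h.2.symm, h.1.symm, rfl, mk_eq_one rfl rfl⟩
  · have : p.x = x := Quad.iterate_x B _ a
    have h' := p.mem
    rwa [this] at h'

theorem continuous_mul : Continuous fun p : {p : Arrow A B × Arrow A B // p.1.src = p.2.rng} =>
    mul p.1.1 p.1.2 := by
  refine ⟨fun U hU => isOpen_iff_forall_mem_open.2 ?_⟩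
  rintro ⟨⟨g, h⟩, hgh⟩ hU'
  obtain ⟨p, q, hpq, rfl, rfl⟩ := exists_rep g h hgh
  replace hU' : mul (mk B p) (mk B q) ∈ U := hU'
  rw [mul_mk hpq] at hU'
  obtain ⟨a, ha⟩ := exists_nbhd_subset hU hU'
  rw [Quad.comp_iterate B hpq] at ha
  refine ⟨Subtype.val ⁻¹' (nbhd B ((Quad.next B)^[a] p) ×ˢ nbhd B ((Quad.next B)^[a] q)), ?_,
    ((isOpen_nbhd _).prod (isOpen_nbhd _)).preimage continuous_subtype_val, ?_⟩
  · rintro ⟨⟨_, _⟩, h⟩ ⟨⟨p', h1, h2, h3, rfl⟩, ⟨q', h4, h5, h6, rfl⟩⟩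
    have hm : p'.Matched B q' := ⟨by rw [h3, h4]; exact (hpq.iterate B a).1, h⟩
    change mul (mk B p') (mk B q') ∈ U
    rw [mul_mk hm]
    exact ha ⟨p'.comp q' hm.1, h1, congrArg₂ (· + ·) h2 h5, h6, rfl⟩
  · constructor
    · have := mem_nbhd (B := B) ((Quad.next B)^[a] p)
      rwa [mk_iterate_next] at this
    · have := mem_nbhd (B := B) ((Quad.next B)^[a] q)
      rwa [mk_iterate_next] at this

theorem continuous_degree : Continuous (degree : Arrow A B → ℤ) := by
  refine continuous_discrete_rng.2 fun n => isOpen_iff_forall_mem_open.2 fun g hg => ?_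
  induction g using Quot.ind with | mk q => ?_
  refine ⟨nbhd B q, ?_, isOpen_nbhd q, mem_nbhd q⟩
  rintro _ ⟨p, h1, h2, h3, rfl⟩
  change (p.α.length : ℤ) - p.β.length = n
  rw [h1, h3]
  exact hg

theorem t2Space (hAB : PseudoFree A B) : T2Space (Arrow A B) := by
  refine ⟨fun g g' hne => ?_⟩
  by_cases hs : g.src = g'.src
  · obtain ⟨q, rfl⟩ : ∃ q, mk B q = g := Quot.exists_rep g
    obtain ⟨q', rfl⟩ : ∃ q', mk B q' = g' := Quot.exists_rep g'
    replace hs : q.x = q'.x := hs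
    rw [← mk_iterate_next B q q'.β.length, ← mk_iterate_next B q' q.β.length] at hne ⊢
    set p := (Quad.next B)^[q'.β.length] q with hp
    set p' := (Quad.next B)^[q.β.length] q' with hp'
    have hx : p.x = p'.x := by rw [hp, hp', Quad.iterate_x, Quad.iterate_x, hs]
    have hl : p.β.length = p'.β.length := by
      rw [hp, hp', Quad.iterate_length_β, Quad.iterate_length_β, add_comm]
    refine ⟨nbhd B p, nbhd B p', isOpen_nbhd _, isOpen_nbhd _, mem_nbhd _, mem_nbhd _, ?_⟩
    rw [Set.disjoint_left]
    rintro _ ⟨r, h1, h2, h3, rfl⟩ ⟨r', h1', h2', h3', h⟩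
    obtain ⟨a, b, hab⟩ := (mk_eq_iff B r' r).1 h
    have h4 := congrArg (fun s => s.β.length) hab
    simp only [Quad.iterate_length_β, h3, h3', hl] at h4
    obtain rfl : a = b := by omega
    have h5 : r' = r := (Quad.next_injective hAB).iterate a hab
    subst h5
    exact hne (congrArg (mk B) (Quad.ext (h1.symm.trans h1') (h2.symm.trans h2')
      (h3.symm.trans h3') hx))
  · exact separated_by_continuous continuous_src hs

end Arrow

variable {B}

/-- The Katsura–Exel–Pardo groupoid of a pseudo free pair of matrices. -/
noncomputable def groupoid (hAB : PseudoFree A B) : EtaleGroupoid.{u} where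
  Obj := InfPath A
  Arr := Arrow A B
  t2Arr := Arrow.t2Space hAB
  src := Arrow.src
  rng := Arrow.rng
  one := Arrow.one
  inv := Arrow.inv
  mul := Arrow.mul
  src_one := Arrow.src_one
  rng_one := Arrow.rng_one
  src_inv := Arrow.src_inv
  rng_inv := Arrow.rng_inv
  src_mul := Arrow.src_mul
  rng_mul := Arrow.rng_mul
  mul_assoc := Arrow.mul_assoc
  one_mul := Arrow.one_mul
  mul_one := Arrow.mul_one
  inv_mul := Arrow.inv_mul
  mul_inv := Arrow.mul_inv
  continuous_one := Arrow.continuous_one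
  continuous_inv := Arrow.continuous_inv
  continuous_mul := Arrow.continuous_mul
  isLocalHomeomorph_src := Arrow.isLocalHomeomorph_src
  isLocalHomeomorph_rng := Arrow.isLocalHomeomorph_rng

/-- The homomorphism `ρ : [α, m, β; x] ↦ |α| - |β|`. -/
noncomputable def rho (hAB : PseudoFree A B) : (groupoid hAB).IntHom where
  toFun := Arrow.degree
  map_mul := Arrow.degree_mul
  continuous_toFun := Arrow.continuous_degree

/-- The groupoid `H_{A,B} = ker ρ`. -/
noncomputable def kernelGroupoid (hAB : PseudoFree A B) : EtaleGroupoid.{u} := (rho hAB).ker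

end Katsura

/-!
The groupoid `H_{A,B}` is the increasing union of the open subgroupoids `H_N` of the arrows
`[α, m, β; x]` with `|α| = |β| = N`, and a compactly supported chain lives on one of them. By pseudo
freeness the number `m` is determined by the arrow, so `[α, m, β; x] ↦ m` is a cocycle `c` on `H_N`.
In the skew product `H_N ×_c ℤ` the arrows `[μ, k, β; x]`, where `μ` depends only on `N` and `r(β)`,
form a continuous section that is invariant under right multiplication. Prepending it to strings is
a contracting homotopy, so the skew product has no homology in positive degrees. The exact sequence
of complexes `0 → C(H_N ×_c ℤ) → C(H_N ×_c ℤ) → C(H_N) → 0`, whose first map is the identity minus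
the shift of `ℤ`, then leaves no homology of `H_N` in degrees at least two.
-/

/-! ### Push-forward of compactly supported functions -/

section Pushforward

variable {X Y : Type*} [TopologicalSpace X] [TopologicalSpace Y] [T2Space X] [T2Space Y]

theorem pushforward_congr {π τ : X → Y} (hπ : IsLocalHomeomorph π) (hτ : IsLocalHomeomorph τ)
    {f : C_c(X, ℤ)} (h : ∀ x, f x ≠ 0 → π x = τ x) : pushforward π hπ f = pushforward τ hτ f := by
  ext y
  rw [pushforward_apply, pushforward_apply]
  refine finsum_congr fun x => ?_
  by_cases hx : f x = 0
  · simp [hx]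
  · simp only [Set.mem_preimage, h x hx]

theorem pushforward_apply_of_injective {π : X → Y} (hπ : IsLocalHomeomorph π)
    (hi : Function.Injective π) (f : C_c(X, ℤ)) (x : X) : pushforward π hπ f (π x) = f x := by
  have h : π ⁻¹' {π x} = {x} := Set.ext fun _ => hi.eq_iff
  rw [pushforward_apply, h, finsum_mem_singleton]

theorem pushforward_injective {π : X → Y} (hπ : IsLocalHomeomorph π)
    (hi : Function.Injective π) : Function.Injective (pushforward π hπ) := by
  intro f g hfg
  ext x
  rw [← pushforward_apply_of_injective hπ hi, hfg, pushforward_apply_of_injective hπ hi]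

theorem pushforward_eq_self {π : X → X} (hπ : IsLocalHomeomorph π) {f : C_c(X, ℤ)}
    (h : ∀ x, f x ≠ 0 → π x = x) : pushforward π hπ f = f := by
  rw [pushforward_congr hπ (Homeomorph.refl X).isLocalHomeomorph h]
  ext x
  exact pushforward_apply_of_injective _ Function.injective_id f x

theorem exists_of_pushforward_ne_zero {π : X → Y} (hπ : IsLocalHomeomorph π) {f : C_c(X, ℤ)}
    {y : Y} (hy : pushforward π hπ f y ≠ 0) : ∃ x, π x = y ∧ f x ≠ 0 := by
  by_contra! h
  exact hy (finsum_mem_eq_zero_of_forall_eq_zero fun x hx => h x hx)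

theorem exists_pushforward_eq_of_support_subset_range {π : X → Y} (hπ : IsLocalHomeomorph π)
    (hi : Function.Injective π) {f : C_c(Y, ℤ)} (hf : Function.support f ⊆ Set.range π) :
    ∃ g, pushforward π hπ g = f := by
  have hclosed : IsClosed (Function.support f) :=
    (isClosed_discrete ({0}ᶜ : Set ℤ)).preimage f.continuous
  have hcompact : IsCompact (Function.support f) := hclosed.closure_eq ▸ f.hasCompactSupport
  have hpre : IsCompact (Function.support (f ∘ π)) :=
    (hπ.isOpenEmbedding_of_injective hi).isInducing.isCompact_preimage' hcompact hf
  let g : C_c(X, ℤ) := ⟨⟨f ∘ π, f.continuous.comp hπ.continuous⟩, hpre.closure⟩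
  refine ⟨g, ?_⟩
  ext y
  by_cases hy : y ∈ Set.range π
  · obtain ⟨x, rfl⟩ := hy
    exact pushforward_apply_of_injective hπ hi g x
  · rw [Function.notMem_support.1 fun h => hy (hf h)]
    by_contra h
    obtain ⟨x, rfl, -⟩ := exists_of_pushforward_ne_zero hπ h
    exact hy ⟨x, rfl⟩

end Pushforward

section Fiberwise

variable {W D : Type*} [TopologicalSpace W] [TopologicalSpace D] [DiscreteTopology D]

theorem finite_image_support {ℓ : W → D} (hℓ : Continuous ℓ) (F : C_c(W, ℤ)) :
    (ℓ '' Function.support F).Finite :=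
  ((F.hasCompactSupport.isCompact.image hℓ).finite_of_discrete).subset
    (Set.image_mono (subset_tsupport F))

theorem mem_of_forall_fiber {ℓ : W → D} (hℓ : Continuous ℓ) (S : AddSubgroup C_c(W, ℤ))
    (hS : ∀ (d : D) (F : C_c(W, ℤ)), (∀ w, F w ≠ 0 → ℓ w = d) → F ∈ S) (F : C_c(W, ℤ)) :
    F ∈ S := by
  classical
  let χ (d : D) : C(W, ℤ) := ⟨fun w => if ℓ w = d then 1 else 0,
    (continuous_of_discreteTopology (f := fun e => if e = d then (1 : ℤ) else 0)).comp hℓ⟩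
  have hχ (d : D) (w : W) : (χ d • F) w = if ℓ w = d then F w else 0 := by
    change (if ℓ w = d then (1 : ℤ) else 0) * F w = _
    rw [ite_mul, one_mul, zero_mul]
  have hfin := finite_image_support hℓ F
  have hF : ∑ d ∈ hfin.toFinset, χ d • F = F := by
    ext w
    rw [CompactlySupportedContinuousMap.sum_apply, Finset.sum_congr rfl fun d _ => hχ d w,
      Finset.sum_ite_eq, ite_eq_left_iff]
    intro hw
    by_contra h
    exact hw (hfin.mem_toFinset.2 ⟨w, Ne.symm h, rfl⟩)
  rw [← hF]
  refine sum_mem fun d _ => hS d _ fun w hw => ?_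
  by_contra h
  exact hw ((hχ d w).trans (if_neg h))

variable {X : Type*} [TopologicalSpace X] [T2Space W] [T2Space X]

-- Modulo the image of `1 - τ_*` all the sections `σ m` agree, and on the fibre `ℓ = m` the
-- identity is `σ m ∘ π`.
theorem exists_sub_pushforward_eq {π : W → X} {τ : W → W} {σ : ℤ → X → W} {ℓ : W → ℤ}
    (hπ : IsLocalHomeomorph π) (hτ : IsLocalHomeomorph τ) (hσ : ∀ m, IsLocalHomeomorph (σ m))
    (hℓ : Continuous ℓ) (hσπ : ∀ w, σ (ℓ w) (π w) = w) (hτσ : ∀ m x, τ (σ m x) = σ (m + 1) x)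
    {F : C_c(W, ℤ)} (hF : pushforward π hπ F = 0) : ∃ E, E - pushforward τ hτ E = F := by
  let T := (AddMonoidHom.id _ - pushforward τ hτ).range
  have hsucc (m : ℤ) (f : C_c(X, ℤ)) :
      pushforward (σ m) (hσ m) f - pushforward (σ (m + 1)) (hσ (m + 1)) f ∈ T := by
    refine ⟨pushforward (σ m) (hσ m) f, ?_⟩
    rw [AddMonoidHom.sub_apply, AddMonoidHom.id_apply, pushforward_comp]
    exact congrArg _ (pushforward_congr _ _ fun x _ => hτσ m x)
  have hconst (m : ℤ) (f : C_c(X, ℤ)) :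
      pushforward (σ m) (hσ m) f - pushforward (σ 0) (hσ 0) f ∈ T := by
    induction m using Int.induction_on with
    | zero => simp only [sub_self, zero_mem]
    | succ n ih => simpa only [neg_sub, sub_add_sub_cancel] using add_mem (neg_mem (hsucc n f)) ih
    | pred n ih =>
      simpa only [sub_add_cancel, sub_add_sub_cancel] using add_mem (hsucc (-n - 1) f) ih
  have hfiber : F ∈ T.comap
      (AddMonoidHom.id _ - (pushforward (σ 0) (hσ 0)).comp (pushforward π hπ)) := by
    refine mem_of_forall_fiber hℓ _ (fun m F' hF' => ?_) F
    have hσF : pushforward (σ m) (hσ m) (pushforward π hπ F') = F' := by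
      rw [pushforward_comp]
      exact pushforward_eq_self _ fun w hw => hF' w hw ▸ hσπ w
    have h := hconst m (pushforward π hπ F')
    rwa [hσF] at h
  simpa [T, hF] using hfiber

theorem eq_zero_of_pushforward_eq_self {τ : W → W} {ℓ : W → ℤ} (hτ : IsLocalHomeomorph τ)
    (hi : Function.Injective τ) (hℓ : Continuous ℓ) (hℓτ : ∀ w, ℓ (τ w) = ℓ w + 1)
    {E : C_c(W, ℤ)} (hE : pushforward τ hτ E = E) : E = 0 := by
  have hinv (w : W) : E (τ w) = E w := by
    conv_lhs => rw [← hE]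
    exact pushforward_apply_of_injective hτ hi E w
  by_contra! hne
  obtain ⟨w, hw⟩ := DFunLike.ne_iff.1 hne
  obtain ⟨_, ⟨v, hv, rfl⟩, hmax⟩ :=
    Set.exists_max_image _ id (finite_image_support hℓ E) ⟨ℓ w, w, hw, rfl⟩
  have hle : ℓ (τ v) ≤ ℓ v := hmax _ ⟨τ v, by rwa [Function.mem_support, hinv], rfl⟩
  rw [hℓτ] at hle
  omega

end Fiberwise

/-! ### Chain maps and vanishing criteria -/

namespace EtaleGroupoid

universe v

section Homology

variable {G : EtaleGroupoid.{u}}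

theorem boundary_apply (n : ℕ) (f : C_c(G.Strings (n + 1), ℤ)) : G.boundary n f =
    ∑ i : Fin (n + 2), (-1 : ℤ) ^ (i : ℕ) •
      pushforward (G.face n i) (G.isLocalHomeomorph_face n i) f := by
  simp only [boundary, AddMonoidHom.finsetSum_apply, AddMonoidHom.smul_apply]

theorem subsingleton_homology_iff {n : ℕ} :
    Subsingleton (G.Homology n) ↔ ∀ f ∈ G.cycles n, ∃ f', G.boundary n f' = f :=
  QuotientAddGroup.subsingleton_iff.trans AddSubgroup.addSubgroupOf_eq_top

end Homology

/-- A continuous homomorphism of étale groupoids that is a local homeomorphism on units. Such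
homomorphisms act on chains by push-forward. -/
structure EtaleHom (G : EtaleGroupoid.{u}) (H : EtaleGroupoid.{v}) where
  toObj : G.Obj → H.Obj
  toArr : G.Arr → H.Arr
  src_toArr : ∀ g, H.src (toArr g) = toObj (G.src g)
  rng_toArr : ∀ g, H.rng (toArr g) = toObj (G.rng g)
  map_mul : ∀ g h, G.src g = G.rng h → toArr (G.mul g h) = H.mul (toArr g) (toArr h)
  continuous_toArr : Continuous toArr
  isLocalHomeomorph_toObj : IsLocalHomeomorph toObj

namespace EtaleHom

variable {G : EtaleGroupoid.{u}} {H : EtaleGroupoid.{v}} (φ : EtaleHom G H)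

/-- The map of composable strings induced by a homomorphism. -/
def onStrings : (n : ℕ) → G.Strings n → H.Strings n
  | 0, x => φ.toObj x
  | _ + 1, s => ⟨fun i => φ.toArr (s.1 i), fun i => by
      rw [φ.src_toArr, φ.rng_toArr, s.2 i]⟩

theorem continuous_onStrings : (n : ℕ) → Continuous (φ.onStrings n)
  | 0 => φ.isLocalHomeomorph_toObj.continuous
  | _ + 1 => (continuous_pi fun i => φ.continuous_toArr.comp
      ((continuous_apply i).comp continuous_subtype_val)).subtype_mk _

theorem onStrings_injective (hObj : Function.Injective φ.toObj)
    (hArr : Function.Injective φ.toArr) : (n : ℕ) → Function.Injective (φ.onStrings n)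
  | 0 => hObj
  | _ + 1 => fun _ _ h => Subtype.ext (hArr.comp_left (congrArg Subtype.val h))

theorem firstUnit_onStrings (n : ℕ) (s : G.Strings n) :
    H.firstUnit n (φ.onStrings n s) = φ.toObj (G.firstUnit n s) := by
  cases n with
  | zero => rfl
  | succ n => exact φ.rng_toArr _

theorem lastUnit_onStrings (n : ℕ) (s : G.Strings n) :
    H.lastUnit n (φ.onStrings n s) = φ.toObj (G.lastUnit n s) := by
  cases n with
  | zero => rfl
  | succ n => exact φ.src_toArr _

theorem isLocalHomeomorph_onStrings (n : ℕ) : IsLocalHomeomorph (φ.onStrings n) := by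
  refine .of_comp (g := H.lastUnit n) ?_ (H.isLocalHomeomorph_lastUnit n) (φ.continuous_onStrings n)
  rw [show H.lastUnit n ∘ φ.onStrings n = φ.toObj ∘ G.lastUnit n from
    funext (φ.lastUnit_onStrings n)]
  exact φ.isLocalHomeomorph_toObj.comp (G.isLocalHomeomorph_lastUnit n)

theorem face_onStrings (n : ℕ) (i : Fin (n + 2)) (s : G.Strings (n + 1)) :
    H.face n i (φ.onStrings (n + 1) s) = φ.onStrings n (G.face n i s) := by
  cases n with
  | zero =>
    induction i using Fin.cases with
    | zero => exact φ.src_toArr _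
    | succ _ => exact φ.rng_toArr _
  | succ n =>
    refine Subtype.ext (funext fun k => ?_)
    change _ = φ.toArr ((G.face (n + 1) i s).1 k)
    rw [face_succ_apply, face_succ_apply]
    split_ifs
    · rfl
    · exact (φ.map_mul _ _ (s.2 k)).symm
    · rfl

/-- The chain map `C_c(G^(n), ℤ) → C_c(H^(n), ℤ)` induced by a homomorphism. -/
noncomputable def chainMap (n : ℕ) : C_c(G.Strings n, ℤ) →+ C_c(H.Strings n, ℤ) :=
  pushforward (φ.onStrings n) (φ.isLocalHomeomorph_onStrings n)

theorem boundary_chainMap (n : ℕ) (f : C_c(G.Strings (n + 1), ℤ)) :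
    H.boundary n (φ.chainMap (n + 1) f) = φ.chainMap n (G.boundary n f) := by
  simp only [boundary_apply, chainMap, map_sum, map_zsmul, pushforward_comp]
  refine Finset.sum_congr rfl fun i _ => congrArg _ ?_
  exact pushforward_congr _ _ fun s _ => φ.face_onStrings n i s

theorem mem_cycles_of_chainMap_mem (hφ : ∀ n, Function.Injective (φ.onStrings n)) {n : ℕ}
    {f : C_c(G.Strings n, ℤ)} (hf : φ.chainMap n f ∈ H.cycles n) : f ∈ G.cycles n := by
  cases n with
  | zero => exact AddSubgroup.mem_top f
  | succ n =>
    refine pushforward_injective (φ.isLocalHomeomorph_onStrings n) (hφ n) ?_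
    rw [map_zero]
    exact (φ.boundary_chainMap n f).symm.trans hf

end EtaleHom

variable {G : EtaleGroupoid.{u}}

theorem firstUnit_face_zero (n : ℕ) (s : G.Strings (n + 1)) :
    G.firstUnit n (G.face n 0 s) = G.src (s.1 0) := by
  cases n with
  | zero => rfl
  | succ n => exact (s.2 0).symm

theorem firstUnit_face_succ (n : ℕ) (j : Fin (n + 1)) (s : G.Strings (n + 1)) :
    G.firstUnit n (G.face n j.succ s) = G.rng (s.1 0) := by
  cases n with
  | zero => rfl
  | succ n =>
    change G.rng ((G.face (n + 1) j.succ s).1 0) = G.rng (s.1 0)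
    rw [face_succ_apply]
    split_ifs with hlt heq
    · rfl
    · exact G.rng_mul _ _ (s.2 0)
    · simp only [Fin.val_zero, Fin.val_succ] at hlt heq
      omega

theorem strings_ext {n : ℕ} {s t : G.Strings (n + 1)} (h0 : s.1 0 = t.1 0)
    (h : G.face n 0 s = G.face n 0 t) : s = t := by
  refine Subtype.ext (funext fun i => ?_)
  induction i using Fin.cases with
  | zero => exact h0
  | succ i =>
    cases n with
    | zero => exact i.elim0
    | succ n => exact congrFun (congrArg Subtype.val h) i

variable (G) in
/-- A continuous choice of an arrow `sec x` out of every unit `x` that is invariant under right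
multiplication. All arrows `sec x` with `x` in one orbit then have the same range, and prepending
them to strings contracts the chain complex of `G` in positive degrees. -/
structure ContractingSection where
  sec : G.Obj → G.Arr
  src_sec : ∀ x, G.src (sec x) = x
  sec_mul : ∀ g, G.mul (sec (G.rng g)) g = sec (G.src g)
  continuous_sec : Continuous sec

namespace ContractingSection

variable (S : G.ContractingSection)

/-- The extra degeneracy `(g_1, …, g_n) ↦ (sec (rng g_1), g_1, …, g_n)`. -/
def extend : (n : ℕ) → G.Strings n → G.Strings (n + 1)
  | 0, x => ⟨fun _ => S.sec x, fun i => i.elim0⟩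
  | _ + 1, s => ⟨Fin.cons (S.sec (G.rng (s.1 0))) s.1,
      Fin.cases (S.src_sec _) fun i => s.2 i⟩

theorem continuous_extend : (n : ℕ) → Continuous (S.extend n)
  | 0 => (continuous_pi fun _ => S.continuous_sec).subtype_mk _
  | n + 1 => by
      have hsec : Continuous fun s : G.Strings (n + 1) => S.sec (G.rng (s.1 0)) :=
        S.continuous_sec.comp (G.continuous_firstUnit (n + 1))
      have hval : Continuous fun s : G.Strings (n + 1) => s.1 := continuous_subtype_val
      exact Continuous.subtype_mk (Continuous.finCons hsec hval) _

theorem extend_apply_zero (n : ℕ) (s : G.Strings n) :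
    (S.extend n s).1 0 = S.sec (G.firstUnit n s) := by
  cases n <;> rfl

theorem face_zero_extend (n : ℕ) (s : G.Strings n) : G.face n 0 (S.extend n s) = s := by
  cases n with
  | zero => exact S.src_sec s
  | succ n => rfl

theorem isLocalHomeomorph_extend (n : ℕ) : IsLocalHomeomorph (S.extend n) := by
  refine .of_comp (g := G.face n 0) ?_ (G.isLocalHomeomorph_face n 0) (S.continuous_extend n)
  rw [show G.face n 0 ∘ S.extend n = id from funext (S.face_zero_extend n)]
  exact (Homeomorph.refl _).isLocalHomeomorph

theorem face_succ_extend (n : ℕ) (i : Fin (n + 2)) (s : G.Strings (n + 1)) :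
    G.face (n + 1) i.succ (S.extend (n + 1) s) = S.extend n (G.face n i s) := by
  apply strings_ext
  · rw [extend_apply_zero, face_succ_apply]
    induction i using Fin.cases with
    | zero =>
      rw [firstUnit_face_zero, ← S.sec_mul, if_neg (by simp), if_pos (by simp)]
      rfl
    | succ j =>
      rw [firstUnit_face_succ]
      exact if_pos (by simp)
  · rw [face_zero_extend, G.face_face 0 i (Fin.zero_le i), Fin.castSucc_zero, face_zero_extend]

/-- The map of chains induced by the extra degeneracy, a contracting homotopy. -/
noncomputable def homotopy (n : ℕ) : C_c(G.Strings n, ℤ) →+ C_c(G.Strings (n + 1), ℤ) :=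
  pushforward (S.extend n) (S.isLocalHomeomorph_extend n)

theorem boundary_homotopy (n : ℕ) (f : C_c(G.Strings (n + 1), ℤ)) :
    G.boundary (n + 1) (S.homotopy (n + 1) f) = f - S.homotopy n (G.boundary n f) := by
  have hzero : pushforward (G.face (n + 1) 0) (G.isLocalHomeomorph_face (n + 1) 0)
      (S.homotopy (n + 1) f) = f := by
    rw [homotopy, pushforward_comp]
    exact pushforward_eq_self _ fun s _ => S.face_zero_extend (n + 1) s
  have hsucc (i : Fin (n + 2)) :
      pushforward (G.face (n + 1) i.succ) (G.isLocalHomeomorph_face (n + 1) i.succ)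
        (S.homotopy (n + 1) f) =
      S.homotopy n (pushforward (G.face n i) (G.isLocalHomeomorph_face n i) f) := by
    rw [homotopy, homotopy, pushforward_comp, pushforward_comp]
    exact pushforward_congr _ _ fun s _ => S.face_succ_extend n i s
  rw [boundary_apply, Fin.sum_univ_succ, hzero, boundary_apply, map_sum, sub_eq_add_neg,
    ← Finset.sum_neg_distrib]
  simp only [Fin.val_zero, pow_zero, one_smul, hsucc, Fin.val_succ, pow_succ', neg_one_mul,
    neg_smul, map_zsmul]

theorem subsingleton_homology_succ (S : G.ContractingSection) (n : ℕ) :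
    Subsingleton (G.Homology (n + 1)) := by
  refine subsingleton_homology_iff.2 fun f hf => ⟨S.homotopy (n + 1) f, ?_⟩
  rw [S.boundary_homotopy, show G.boundary n f = 0 from hf, map_zero, sub_zero]

end ContractingSection

end EtaleGroupoid

/-! ### The skew product by a cocycle -/

theorem isLocalHomeomorph_fst {X D : Type*} [TopologicalSpace X] [TopologicalSpace D]
    [DiscreteTopology D] : IsLocalHomeomorph (Prod.fst : X × D → X) := by
  refine isLocalHomeomorph_of_locallyInjective_of_isOpenMap continuous_fst isOpenMap_fst fun p => ?_
  refine ⟨Prod.snd ⁻¹' {p.2}, (isOpen_discrete _).preimage continuous_snd, rfl, ?_⟩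
  intro q hq q' hq' h
  exact Prod.ext h (hq.trans hq'.symm)

namespace EtaleGroupoid

namespace IntHom

variable {G : EtaleGroupoid.{u}} (c : G.IntHom)

/-- The skew product `G ×_c ℤ`, the `ℤ`-covering of `G` on which `c` becomes a coboundary: over an
arrow `g` there is one arrow for each `k : ℤ`, from `(src g, k + c g)` to `(rng g, k)`. -/
def skewProduct : EtaleGroupoid.{u} where
  Obj := G.Obj × ℤ
  Arr := G.Arr × ℤ
  src p := (G.src p.1, p.2 + c.toFun p.1)
  rng p := (G.rng p.1, p.2)
  one p := (G.one p.1, p.2)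
  inv p := (G.inv p.1, p.2 + c.toFun p.1)
  mul p q := (G.mul p.1 q.1, p.2)
  src_one p := by rw [c.map_one, G.src_one, add_zero]
  rng_one p := by rw [G.rng_one]
  src_inv p := by rw [c.map_inv, G.src_inv, add_neg_cancel_right]
  rng_inv p := by rw [G.rng_inv]
  src_mul p q h := by
    have hpq : G.src p.1 = G.rng q.1 := congrArg Prod.fst h
    have hlevel : p.2 + c.toFun p.1 = q.2 := congrArg Prod.snd h
    rw [c.map_mul _ _ hpq, G.src_mul _ _ hpq, ← add_assoc, hlevel]
  rng_mul p q h := by rw [G.rng_mul _ _ (congrArg Prod.fst h)]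
  mul_assoc p q r hpq hqr := by
    rw [G.mul_assoc _ _ _ (congrArg Prod.fst hpq) (congrArg Prod.fst hqr)]
  one_mul p := by rw [G.one_mul]
  mul_one p := by rw [G.mul_one]
  inv_mul p := by rw [G.inv_mul]
  mul_inv p := by rw [G.mul_inv]
  continuous_one := (G.continuous_one.comp continuous_fst).prodMk continuous_snd
  continuous_inv := (G.continuous_inv.comp continuous_fst).prodMk
    (continuous_snd.add (c.continuous_toFun.comp continuous_fst))
  continuous_mul := by
    have hfst : Continuous fun p : {p : (G.Arr × ℤ) × G.Arr × ℤ //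
        (G.src p.1.1, p.1.2 + c.toFun p.1.1) = (G.rng p.2.1, p.2.2)} =>
        (⟨(p.1.1.1, p.1.2.1), congrArg Prod.fst p.2⟩ :
          {p : G.Arr × G.Arr // G.src p.1 = G.rng p.2}) := by fun_prop
    exact (G.continuous_mul.comp hfst).prodMk
      (continuous_snd.comp (continuous_fst.comp continuous_subtype_val))
  isLocalHomeomorph_src := .of_comp (g := Prod.fst)
    (G.isLocalHomeomorph_src.comp isLocalHomeomorph_fst) isLocalHomeomorph_fst
    ((G.isLocalHomeomorph_src.continuous.comp continuous_fst).prodMk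
      (continuous_snd.add (c.continuous_toFun.comp continuous_fst)))
  isLocalHomeomorph_rng := .of_comp (g := Prod.fst)
    (G.isLocalHomeomorph_rng.comp isLocalHomeomorph_fst) isLocalHomeomorph_fst
    ((G.isLocalHomeomorph_rng.continuous.comp continuous_fst).prodMk continuous_snd)

/-- The covering map `G ×_c ℤ → G`. -/
def skewProj : EtaleHom c.skewProduct G where
  toObj := Prod.fst
  toArr := Prod.fst
  src_toArr _ := rfl
  rng_toArr _ := rfl
  map_mul _ _ _ := rfl
  continuous_toArr := continuous_fst
  isLocalHomeomorph_toObj := isLocalHomeomorph_fst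

/-- The generator `k ↦ k + 1` of the deck transformations of `G ×_c ℤ`. -/
def skewShift : EtaleHom c.skewProduct c.skewProduct where
  toObj x := (x.1, x.2 + 1)
  toArr p := (p.1, p.2 + 1)
  src_toArr _ := Prod.ext rfl (add_right_comm _ _ _)
  rng_toArr _ := rfl
  map_mul _ _ _ := rfl
  continuous_toArr := continuous_fst.prodMk (continuous_snd.add continuous_const)
  isLocalHomeomorph_toObj := .of_comp (g := Prod.fst) isLocalHomeomorph_fst isLocalHomeomorph_fst
    (continuous_fst.prodMk (continuous_snd.add continuous_const))

/-- The `ℤ`-coordinate of the first unit of a string of `G ×_c ℤ`. -/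
def skewLevel (n : ℕ) (w : c.skewProduct.Strings n) : ℤ := (c.skewProduct.firstUnit n w).2

/-- The unique lift of a string of `G` to a string of `G ×_c ℤ` with level `m`. -/
def skewLift (m : ℤ) : (n : ℕ) → G.Strings n → c.skewProduct.Strings n
  | 0, x => (x, m)
  | _ + 1, s => ⟨fun i => (s.1 i, m + Fin.partialSum (fun j => c.toFun (s.1 j)) i.castSucc),
      fun i => Prod.ext (s.2 i) (by
        change _ + _ = m + Fin.partialSum _ i.castSucc.succ
        rw [Fin.partialSum_succ, ← add_assoc])⟩

theorem continuous_skewLevel (n : ℕ) : Continuous (c.skewLevel n) :=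
  continuous_snd.comp (c.skewProduct.continuous_firstUnit n)

theorem continuous_partialSum_toFun {n : ℕ} (i : Fin (n + 2)) :
    Continuous fun s : G.Strings (n + 1) => Fin.partialSum (fun j => c.toFun (s.1 j)) i := by
  induction i using Fin.induction with
  | zero => simpa only [Fin.partialSum_zero] using continuous_const
  | succ i ih =>
    simp only [Fin.partialSum_succ]
    exact ih.add (c.continuous_toFun.comp ((continuous_apply i).comp continuous_subtype_val))

theorem continuous_skewLift (m : ℤ) : (n : ℕ) → Continuous (c.skewLift m n)
  | 0 => continuous_id.prodMk continuous_const
  | n + 1 => by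
    refine Continuous.subtype_mk (continuous_pi fun i => Continuous.prodMk ?_ ?_) _
    · exact (continuous_apply i).comp continuous_subtype_val
    · exact continuous_const.add (c.continuous_partialSum_toFun i.castSucc)

theorem skewProj_skewLift (m : ℤ) (n : ℕ) (s : G.Strings n) :
    c.skewProj.onStrings n (c.skewLift m n s) = s := by
  cases n <;> rfl

theorem isLocalHomeomorph_skewLift (m : ℤ) (n : ℕ) : IsLocalHomeomorph (c.skewLift m n) := by
  refine .of_comp (g := c.skewProj.onStrings n) ?_ (c.skewProj.isLocalHomeomorph_onStrings n)
    (c.continuous_skewLift m n)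
  rw [show c.skewProj.onStrings n ∘ c.skewLift m n = id from funext (c.skewProj_skewLift m n)]
  exact (Homeomorph.refl _).isLocalHomeomorph

theorem skewLift_skewProj (n : ℕ) (w : c.skewProduct.Strings n) :
    c.skewLift (c.skewLevel n w) n (c.skewProj.onStrings n w) = w := by
  cases n with
  | zero => rfl
  | succ n =>
    refine Subtype.ext (funext fun i => Prod.ext rfl ?_)
    change (w.1 0).2 + Fin.partialSum (fun j => c.toFun (w.1 j).1) i.castSucc = (w.1 i).2
    induction i using Fin.induction with
    | zero => rw [Fin.castSucc_zero, Fin.partialSum_zero, add_zero]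
    | succ i ih =>
      rw [← Fin.succ_castSucc, Fin.partialSum_succ, ← add_assoc, ih]
      exact congrArg Prod.snd (w.2 i)

theorem skewShift_skewLift (m : ℤ) (n : ℕ) (s : G.Strings n) :
    c.skewShift.onStrings n (c.skewLift m n s) = c.skewLift (m + 1) n s := by
  cases n with
  | zero => rfl
  | succ n => exact Subtype.ext (funext fun i => Prod.ext rfl (add_right_comm _ _ _))

theorem skewLevel_skewShift (n : ℕ) (w : c.skewProduct.Strings n) :
    c.skewLevel n (c.skewShift.onStrings n w) = c.skewLevel n w + 1 :=
  congrArg Prod.snd (c.skewShift.firstUnit_onStrings n w)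

theorem skewProj_skewShift (n : ℕ) (w : c.skewProduct.Strings n) :
    c.skewProj.onStrings n (c.skewShift.onStrings n w) = c.skewProj.onStrings n w := by
  cases n <;> rfl

theorem skewShift_onStrings_injective (n : ℕ) : Function.Injective (c.skewShift.onStrings n) := by
  have h {X : Type u} : Function.Injective fun p : X × ℤ => (p.1, p.2 + 1) :=
    Function.injective_id.prodMap (add_left_injective 1)
  exact c.skewShift.onStrings_injective h h n

theorem skewProj_chainMap_surjective (n : ℕ) : Function.Surjective (c.skewProj.chainMap n) := by
  refine fun f => ⟨pushforward (c.skewLift 0 n) (c.isLocalHomeomorph_skewLift 0 n) f, ?_⟩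
  rw [EtaleHom.chainMap, pushforward_comp]
  exact pushforward_eq_self _ fun s _ => c.skewProj_skewLift 0 n s

theorem skewProj_chainMap_skewShift (n : ℕ) (E : C_c(c.skewProduct.Strings n, ℤ)) :
    c.skewProj.chainMap n (c.skewShift.chainMap n E) = c.skewProj.chainMap n E := by
  rw [EtaleHom.chainMap, EtaleHom.chainMap, pushforward_comp]
  exact pushforward_congr _ _ fun w _ => c.skewProj_skewShift n w

theorem exists_sub_skewShift_eq {n : ℕ} {F : C_c(c.skewProduct.Strings n, ℤ)}
    (hF : c.skewProj.chainMap n F = 0) : ∃ E, E - c.skewShift.chainMap n E = F :=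
  exists_sub_pushforward_eq _ _ (fun m => c.isLocalHomeomorph_skewLift m n)
    (c.continuous_skewLevel n) (c.skewLift_skewProj n) (fun m => c.skewShift_skewLift m n) hF

theorem eq_zero_of_skewShift_eq_self {n : ℕ} {E : C_c(c.skewProduct.Strings n, ℤ)}
    (hE : c.skewShift.chainMap n E = E) : E = 0 :=
  eq_zero_of_pushforward_eq_self _ (c.skewShift_onStrings_injective n) (c.continuous_skewLevel n)
    (c.skewLevel_skewShift n) hE

theorem mem_cycles_of_sub_skewShift_eq_boundary {n : ℕ} {E : C_c(c.skewProduct.Strings n, ℤ)}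
    {F : C_c(c.skewProduct.Strings (n + 1), ℤ)}
    (h : E - c.skewShift.chainMap n E = c.skewProduct.boundary n F) :
    E ∈ c.skewProduct.cycles n := by
  cases n with
  | zero => exact AddSubgroup.mem_top E
  | succ n =>
    refine c.eq_zero_of_skewShift_eq_self (sub_eq_zero.1 ?_).symm
    rw [← EtaleHom.boundary_chainMap, ← map_sub, h, boundary_boundary]

-- A diagram chase in the exact sequence of complexes `0 → C(G ×_c ℤ) → C(G ×_c ℤ) → C(G) → 0`,
-- whose first map is `1 - τ_*` for the shift `τ`.
theorem subsingleton_homology_succ_of_skewProduct {n : ℕ}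
    (hn : Subsingleton (c.skewProduct.Homology n))
    (hn' : Subsingleton (c.skewProduct.Homology (n + 1))) : Subsingleton (G.Homology (n + 1)) := by
  rw [subsingleton_homology_iff] at hn hn' ⊢
  intro f hf
  obtain ⟨F, rfl⟩ := c.skewProj_chainMap_surjective (n + 1) f
  obtain ⟨E, hE⟩ : ∃ E, E - c.skewShift.chainMap n E = c.skewProduct.boundary n F :=
    c.exists_sub_skewShift_eq ((c.skewProj.boundary_chainMap n F).symm.trans hf)
  obtain ⟨D, rfl⟩ := hn E (c.mem_cycles_of_sub_skewShift_eq_boundary hE)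
  have hcycle : F - (D - c.skewShift.chainMap (n + 1) D) ∈ c.skewProduct.cycles (n + 1) := by
    change c.skewProduct.boundary n _ = 0
    rw [map_sub, map_sub, EtaleHom.boundary_chainMap, hE, sub_self]
  obtain ⟨D', hD'⟩ := hn' _ hcycle
  refine ⟨c.skewProj.chainMap (n + 2) D', ?_⟩
  rw [EtaleHom.boundary_chainMap, hD', map_sub, map_sub, skewProj_chainMap_skewShift, sub_self,
    sub_zero]

end IntHom

end EtaleGroupoid

/-! ### Open subgroupoids -/

namespace EtaleGroupoid

variable {G : EtaleGroupoid.{u}}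

variable (G) in
/-- An open subgroupoid with the same units as `G`, given by its set of arrows. -/
structure OpenSubgroupoid where
  carrier : Set G.Arr
  isOpen_carrier : IsOpen carrier
  one_mem : ∀ x, G.one x ∈ carrier
  inv_mem : ∀ g ∈ carrier, G.inv g ∈ carrier
  mul_mem : ∀ g ∈ carrier, ∀ h ∈ carrier, G.src g = G.rng h → G.mul g h ∈ carrier

namespace OpenSubgroupoid

variable (S : G.OpenSubgroupoid)

open scoped Classical in
/-- The product of `G` restricted to an open subgroupoid. On pairs that are not composable, whose
product in `G` may leave the subgroupoid, it takes the junk value `g`. -/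
noncomputable def subMul (g h : S.carrier) : S.carrier :=
  if hgh : G.src g.1 = G.rng h.1 then ⟨G.mul g.1 h.1, S.mul_mem _ g.2 _ h.2 hgh⟩ else g

theorem subMul_val (g h : S.carrier) (hgh : G.src g.1 = G.rng h.1) :
    (S.subMul g h).1 = G.mul g.1 h.1 := by
  rw [subMul, dif_pos hgh]

theorem isLocalHomeomorph_val : IsLocalHomeomorph (Subtype.val : S.carrier → G.Arr) :=
  S.isOpen_carrier.isOpenEmbedding_subtypeVal.isLocalHomeomorph

theorem continuous_subMul :
    Continuous fun p : {p : S.carrier × S.carrier // G.src p.1.1 = G.rng p.2.1} =>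
      S.subMul p.1.1 p.1.2 := by
  refine Topology.IsInducing.subtypeVal.continuous_iff.2 ?_
  have h : Continuous fun p : {p : S.carrier × S.carrier // G.src p.1.1 = G.rng p.2.1} =>
      (⟨(p.1.1.1, p.1.2.1), p.2⟩ : {p : G.Arr × G.Arr // G.src p.1 = G.rng p.2}) := by fun_prop
  exact (G.continuous_mul.comp h).congr fun p => (S.subMul_val _ _ p.2).symm

/-- An open subgroupoid as an étale groupoid. -/
noncomputable def toGroupoid : EtaleGroupoid.{u} where
  Obj := G.Obj
  Arr := S.carrier
  src g := G.src g.1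
  rng g := G.rng g.1
  one x := ⟨G.one x, S.one_mem x⟩
  inv g := ⟨G.inv g.1, S.inv_mem _ g.2⟩
  mul := S.subMul
  src_one x := G.src_one x
  rng_one x := G.rng_one x
  src_inv g := G.src_inv g.1
  rng_inv g := G.rng_inv g.1
  src_mul g h hgh := by rw [S.subMul_val _ _ hgh, G.src_mul _ _ hgh]
  rng_mul g h hgh := by rw [S.subMul_val _ _ hgh, G.rng_mul _ _ hgh]
  mul_assoc g h k hgh hhk := by
    have hgh_k : G.src (S.subMul g h).1 = G.rng k.1 := by
      rw [S.subMul_val _ _ hgh, G.src_mul _ _ hgh, hhk]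
    have hg_hk : G.src g.1 = G.rng (S.subMul h k).1 := by
      rw [S.subMul_val _ _ hhk, G.rng_mul _ _ hhk, hgh]
    apply Subtype.ext
    rw [S.subMul_val _ _ hgh_k, S.subMul_val _ _ hg_hk, S.subMul_val _ _ hgh, S.subMul_val _ _ hhk,
      G.mul_assoc _ _ _ hgh hhk]
  one_mul g := Subtype.ext ((S.subMul_val _ _ (G.src_one _)).trans (G.one_mul g.1))
  mul_one g := Subtype.ext ((S.subMul_val _ _ (G.rng_one _).symm).trans (G.mul_one g.1))
  inv_mul g := Subtype.ext ((S.subMul_val _ _ (G.src_inv _)).trans (G.inv_mul g.1))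
  mul_inv g := Subtype.ext ((S.subMul_val _ _ (G.rng_inv _).symm).trans (G.mul_inv g.1))
  continuous_one := G.continuous_one.subtype_mk _
  continuous_inv := (G.continuous_inv.comp continuous_subtype_val).subtype_mk _
  continuous_mul := S.continuous_subMul
  isLocalHomeomorph_src := G.isLocalHomeomorph_src.comp S.isLocalHomeomorph_val
  isLocalHomeomorph_rng := G.isLocalHomeomorph_rng.comp S.isLocalHomeomorph_val

/-- The inclusion of an open subgroupoid. -/
noncomputable def inclusion : EtaleHom S.toGroupoid G where
  toObj := id
  toArr := Subtype.val
  src_toArr _ := rfl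
  rng_toArr _ := rfl
  map_mul := S.subMul_val
  continuous_toArr := S.isLocalHomeomorph_val.continuous
  isLocalHomeomorph_toObj := (Homeomorph.refl G.Obj).isLocalHomeomorph

theorem inclusion_onStrings_injective (n : ℕ) : Function.Injective (S.inclusion.onStrings n) :=
  S.inclusion.onStrings_injective Function.injective_id Subtype.val_injective n

theorem mem_range_inclusion_onStrings {n : ℕ} {s : G.Strings (n + 1)} :
    s ∈ Set.range (S.inclusion.onStrings (n + 1)) ↔ ∀ i, s.1 i ∈ S.carrier := by
  constructor
  · rintro ⟨t, rfl⟩ i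
    exact (t.1 i).2
  · exact fun hs => ⟨⟨fun i => ⟨s.1 i, hs i⟩, s.2⟩, rfl⟩

end OpenSubgroupoid

section DirectedUnion

variable {ι : Type*} {S : ι → G.OpenSubgroupoid}

theorem directed_range_inclusion_onStrings (hdir : Directed (· ⊆ ·) fun i => (S i).carrier)
    (n : ℕ) : Directed (· ⊆ ·) fun i => Set.range ((S i).inclusion.onStrings n) := by
  refine fun i j => (hdir i j).imp fun k hk => ?_
  cases n with
  | zero => exact ⟨subset_rfl, subset_rfl⟩
  | succ n =>
    simp only [Set.subset_def, OpenSubgroupoid.mem_range_inclusion_onStrings]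
    exact ⟨fun s hs a => hk.1 (hs a), fun s hs a => hk.2 (hs a)⟩

variable [Nonempty ι]

theorem exists_mem_range_inclusion_onStrings (hdir : Directed (· ⊆ ·) fun i => (S i).carrier)
    (hcover : ∀ g, ∃ i, g ∈ (S i).carrier) {n : ℕ} (s : G.Strings n) :
    ∃ i, s ∈ Set.range ((S i).inclusion.onStrings n) := by
  cases n with
  | zero => exact ⟨Classical.arbitrary ι, s, rfl⟩
  | succ n =>
    choose index hindex using fun j => hcover (s.1 j)
    obtain ⟨i, hi⟩ := hdir.finite_le index
    exact ⟨i, (S i).mem_range_inclusion_onStrings.2 fun j => hi j (hindex j)⟩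

theorem exists_support_subset_range_inclusion (hdir : Directed (· ⊆ ·) fun i => (S i).carrier)
    (hcover : ∀ g, ∃ i, g ∈ (S i).carrier) {n : ℕ} (f : C_c(G.Strings n, ℤ)) :
    ∃ i, Function.support f ⊆ Set.range ((S i).inclusion.onStrings n) := by
  obtain ⟨i, hi⟩ := f.hasCompactSupport.isCompact.elim_directed_cover
    (fun i => Set.range ((S i).inclusion.onStrings n))
    (fun i => ((S i).inclusion.isLocalHomeomorph_onStrings n).isOpenMap.isOpen_range)
    (fun s _ => Set.mem_iUnion.2 (exists_mem_range_inclusion_onStrings hdir hcover s))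
    (directed_range_inclusion_onStrings hdir n)
  exact ⟨i, (subset_tsupport f).trans hi⟩

theorem subsingleton_homology_of_directed (hdir : Directed (· ⊆ ·) fun i => (S i).carrier)
    (hcover : ∀ g, ∃ i, g ∈ (S i).carrier) {n : ℕ}
    (hS : ∀ i, Subsingleton ((S i).toGroupoid.Homology n)) : Subsingleton (G.Homology n) := by
  simp only [subsingleton_homology_iff] at hS ⊢
  intro f hf
  obtain ⟨i, hi⟩ := exists_support_subset_range_inclusion hdir hcover f
  have hinj := (S i).inclusion_onStrings_injective
  obtain ⟨f, rfl⟩ := exists_pushforward_eq_of_support_subset_range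
    ((S i).inclusion.isLocalHomeomorph_onStrings n) (hinj n) hi
  obtain ⟨f', rfl⟩ := hS i f ((S i).inclusion.mem_cycles_of_chainMap_mem hinj hf)
  exact ⟨(S i).inclusion.chainMap (n + 1) f', (S i).inclusion.boundary_chainMap n f'⟩

end DirectedUnion

end EtaleGroupoid

/-! ### The filtration of the kernel groupoid by path length -/

namespace Katsura

variable {V : Type u} {A B : Matrix V V ℤ}

theorem exists_mem_cylinder (x : InfPath A) (N : ℕ) :
    ∃ β : FinPath A, β.length = N ∧ x ∈ cylinder β := by
  induction N with
  | zero => exact ⟨.vertex x.src, rfl, x, rfl, rfl⟩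
  | succ N ih =>
    obtain ⟨β, rfl, hx⟩ := ih
    exact ⟨_, β.length_snoc _ _, mem_cylinder_snoc hx (src_drop_of_mem hx)⟩

/-- The path formed by the first `N` edges of `x`. -/
noncomputable def InfPath.take (N : ℕ) (x : InfPath A) : FinPath A :=
  (exists_mem_cylinder x N).choose

theorem InfPath.length_take (N : ℕ) (x : InfPath A) : (InfPath.take N x).length = N :=
  (exists_mem_cylinder x N).choose_spec.1

theorem InfPath.mem_cylinder_take (N : ℕ) (x : InfPath A) : x ∈ cylinder (InfPath.take N x) :=
  (exists_mem_cylinder x N).choose_spec.2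

theorem InfPath.take_eq {N : ℕ} {x : InfPath A} {β : FinPath A} (hx : x ∈ cylinder β)
    (hβ : β.length = N) : InfPath.take N x = β :=
  eq_of_mem_cylinder (InfPath.mem_cylinder_take N x) hx ((InfPath.length_take N x).trans hβ.symm)

/-- A path of length `|β|` that ends where `β` ends and depends only on `|β|` and `r(β)`. -/
noncomputable def standardPath (β : FinPath A) : FinPath A :=
  Set.rangeSplitting (fun μ : FinPath A => (μ.length, μ.rng)) ⟨_, Set.mem_range_self β⟩

theorem length_standardPath (β : FinPath A) : (standardPath β).length = β.length :=
  congrArg Prod.fst (Set.apply_rangeSplitting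
    (fun μ : FinPath A => (μ.length, μ.rng)) ⟨_, Set.mem_range_self β⟩)

theorem rng_standardPath (β : FinPath A) : (standardPath β).rng = β.rng :=
  congrArg Prod.snd (Set.apply_rangeSplitting
    (fun μ : FinPath A => (μ.length, μ.rng)) ⟨_, Set.mem_range_self β⟩)

theorem standardPath_congr {β β' : FinPath A} (hlen : β.length = β'.length)
    (hrng : β.rng = β'.rng) : standardPath β = standardPath β' := by
  simp only [standardPath, hlen, hrng]

theorem eq_of_mk_eq (hAB : PseudoFree A B) {q q' : Quad A} (h : mk B q = mk B q')
    (hβ : q.β.length = q'.β.length) : q = q' := by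
  obtain ⟨a, b, hab⟩ := (mk_eq_iff B q q').1 h
  obtain rfl : a = b := by
    have hlen := congrArg (fun r => r.β.length) hab
    simp only [Quad.iterate_length_β, hβ] at hlen
    omega
  exact (Quad.next_injective hAB).iterate a hab

namespace Arrow

/-- The arrow has the form `[α, m, β; x]` with `|α| = |β| = N`. -/
def IsLevel (N : ℕ) (g : Arrow A B) : Prop :=
  ∃ q : Quad A, q.α.length = N ∧ q.β.length = N ∧ mk B q = g

theorem isLevel_one (N : ℕ) (x : InfPath A) : IsLevel N (one x : Arrow A B) :=
  ⟨⟨InfPath.take N x, 0, InfPath.take N x, x, rfl, InfPath.mem_cylinder_take N x⟩,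
    InfPath.length_take N x, InfPath.length_take N x, mk_eq_one rfl rfl⟩

theorem IsLevel.inv {N : ℕ} {g : Arrow A B} (hg : IsLevel N g) : IsLevel N g.inv := by
  obtain ⟨q, hα, hβ, rfl⟩ := hg
  exact ⟨q.inv B, hβ, hα, rfl⟩

theorem matched_of_length {q q' : Quad A} (h : q.β.length = q'.α.length)
    (hx : (mk B q).src = (mk B q').rng) : q.Matched B q' :=
  have hx' : q.x = q'.rng B := hx
  ⟨eq_of_mem_cylinder q.mem (hx' ▸ q'.rng_mem B) h, hx'⟩

theorem IsLevel.mul {N : ℕ} {g h : Arrow A B} (hg : IsLevel N g) (hh : IsLevel N h)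
    (hgh : g.src = h.rng) : IsLevel N (mul g h) := by
  obtain ⟨q, hα, hβ, rfl⟩ := hg
  obtain ⟨q', hα', hβ', rfl⟩ := hh
  have hmatched := matched_of_length (hβ.trans hα'.symm) hgh
  exact ⟨q.comp q' hmatched.1, hα, hβ', (mul_mk hmatched).symm⟩

theorem isOpen_isLevel (N : ℕ) : IsOpen {g : Arrow A B | IsLevel N g} := by
  refine isOpen_iff_forall_mem_open.2 ?_
  rintro _ ⟨q, hα, hβ, rfl⟩
  refine ⟨nbhd B q, ?_, isOpen_nbhd q, mem_nbhd q⟩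
  rintro _ ⟨p, hpα, -, hpβ, rfl⟩
  exact ⟨p, by rw [hpα, hα], by rw [hpβ, hβ], rfl⟩

theorem IsLevel.succ {N : ℕ} {g : Arrow A B} (hg : IsLevel N g) : IsLevel (N + 1) g := by
  obtain ⟨q, hα, hβ, rfl⟩ := hg
  exact ⟨q.next B, by rw [Quad.next_length_α, hα], by rw [Quad.next_length_β, hβ], mk_next B q⟩

theorem exists_isLevel {g : Arrow A B} (hg : g.degree = 0) : ∃ N, IsLevel N g := by
  induction g using Quot.ind with | mk q => ?_
  have hlen : (q.α.length : ℤ) - q.β.length = 0 := hg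
  exact ⟨q.β.length, q, by omega, rfl, rfl⟩

open scoped Classical in
/-- The number `m` for an arrow `[α, m, β; x]` with `|α| = |β| = N`. It is well defined for a
pseudo free pair, and `0` for the arrows that are not of this form. -/
noncomputable def levelDeg (N : ℕ) (g : Arrow A B) : ℤ :=
  if h : IsLevel N g then h.choose.m else 0

theorem levelDeg_mk (hAB : PseudoFree A B) {N : ℕ} {q : Quad A} (hα : q.α.length = N)
    (hβ : q.β.length = N) : levelDeg N (mk B q) = q.m := by
  have hlevel : IsLevel N (mk B q) := ⟨q, hα, hβ, rfl⟩
  obtain ⟨-, hβ', hmk⟩ := hlevel.choose_spec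
  rw [levelDeg, dif_pos hlevel, eq_of_mk_eq hAB hmk (hβ'.trans hβ.symm)]

theorem levelDeg_mul (hAB : PseudoFree A B) {N : ℕ} {g h : Arrow A B} (hg : IsLevel N g)
    (hh : IsLevel N h) (hgh : g.src = h.rng) :
    levelDeg N (mul g h) = levelDeg N g + levelDeg N h := by
  obtain ⟨q, hα, hβ, rfl⟩ := hg
  obtain ⟨q', hα', hβ', rfl⟩ := hh
  have hmatched := matched_of_length (hβ.trans hα'.symm) hgh
  rw [mul_mk hmatched, levelDeg_mk hAB hα hβ, levelDeg_mk hAB hα' hβ',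
    levelDeg_mk hAB (q := q.comp q' hmatched.1) hα hβ']
  rfl

theorem eventually_levelDeg_eq (hAB : PseudoFree A B) {N : ℕ} {g : Arrow A B} (hg : IsLevel N g) :
    ∀ᶠ h in nhds g, levelDeg N h = levelDeg N g := by
  obtain ⟨q, hα, hβ, rfl⟩ := hg
  filter_upwards [(isOpen_nbhd (B := B) q).mem_nhds (mem_nbhd q)]
  rintro _ ⟨p, hpα, hpm, hpβ, rfl⟩
  rw [levelDeg_mk hAB hα hβ, levelDeg_mk hAB (by rw [hpα, hα]) (by rw [hpβ, hβ]), hpm]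

/-- The quadruple `(μ, k, β; x)` where `β` consists of the first `N` edges of `x` and `μ` is the
standard path of length `N` that ends where `β` ends. -/
noncomputable def sectionQuad (N : ℕ) (k : ℤ) (x : InfPath A) : Quad A where
  α := standardPath (InfPath.take N x)
  m := k
  β := InfPath.take N x
  x := x
  rng_eq := rng_standardPath _
  mem := InfPath.mem_cylinder_take N x

variable (B) in
/-- The arrow `[μ, k, β; x]` of `sectionQuad`. As `μ` depends only on `r(β)` and `N`, multiplication
on the right by an arrow `[β, m, γ; y]` with `|γ| = N` merely replaces `k` by `k + m`. -/
noncomputable def levelSection (N : ℕ) (k : ℤ) (x : InfPath A) : Arrow A B :=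
  mk B (sectionQuad N k x)

theorem length_sectionQuad_α (N : ℕ) (k : ℤ) (x : InfPath A) :
    (sectionQuad N k x).α.length = N :=
  (length_standardPath _).trans (InfPath.length_take N x)

theorem length_sectionQuad_β (N : ℕ) (k : ℤ) (x : InfPath A) :
    (sectionQuad N k x).β.length = N := InfPath.length_take N x

theorem isLevel_levelSection (N : ℕ) (k : ℤ) (x : InfPath A) :
    IsLevel N (levelSection B N k x) :=
  ⟨_, length_sectionQuad_α N k x, length_sectionQuad_β N k x, rfl⟩

theorem degree_levelSection (N : ℕ) (k : ℤ) (x : InfPath A) :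
    (levelSection B N k x).degree = 0 := by
  change ((sectionQuad N k x).α.length : ℤ) - (sectionQuad N k x).β.length = 0
  rw [length_sectionQuad_α, length_sectionQuad_β, sub_self]

theorem levelDeg_levelSection (hAB : PseudoFree A B) (N : ℕ) (k : ℤ) (x : InfPath A) :
    levelDeg N (levelSection B N k x) = k :=
  levelDeg_mk hAB (length_sectionQuad_α N k x) (length_sectionQuad_β N k x)

theorem continuous_levelSection (N : ℕ) (k : ℤ) :
    Continuous (levelSection B N k : InfPath A → Arrow A B) := by
  refine ⟨fun U hU => isOpen_iff_forall_mem_open.2 fun x hx => ?_⟩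
  let O := nbhd B (sectionQuad N k x)
  have hO : IsOpen O := isOpen_nbhd _
  refine ⟨src '' (U ∩ O), ?_, isOpenMap_src _ (hU.inter hO), levelSection B N k x,
    ⟨hx, mem_nbhd _⟩, rfl⟩
  rintro _ ⟨_, ⟨hpU, ⟨p, hα, hm, hβ, rfl⟩⟩, rfl⟩
  have htake : InfPath.take N p.x = p.β :=
    InfPath.take_eq p.mem ((congrArg FinPath.length hβ).trans (length_sectionQuad_β N k x))
  have hp : sectionQuad N k p.x = p :=
    Quad.ext ((congrArg standardPath (htake.trans hβ)).trans hα.symm) hm.symm htake rfl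
  change mk B (sectionQuad N k p.x) ∈ U
  rwa [hp]

theorem levelSection_mul (hAB : PseudoFree A B) {N : ℕ} (k : ℤ) {g : Arrow A B}
    (hg : IsLevel N g) :
    mul (levelSection B N k g.rng) g = levelSection B N (k + levelDeg N g) g.src := by
  obtain ⟨q, hα, hβ, rfl⟩ := hg
  have htake_rng : InfPath.take N (q.rng B) = q.α := InfPath.take_eq (q.rng_mem B) hα
  have htake_src : InfPath.take N q.x = q.β := InfPath.take_eq q.mem hβ
  have hmatched : (sectionQuad N k (q.rng B)).Matched B q := ⟨htake_rng, rfl⟩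
  have hstandard : standardPath (InfPath.take N (q.rng B)) = standardPath (InfPath.take N q.x) := by
    rw [htake_rng, htake_src]
    exact standardPath_congr (hα.trans hβ.symm) q.rng_eq
  rw [levelDeg_mk hAB hα hβ]
  exact (mul_mk hmatched).trans
    (congrArg (mk B) (Quad.ext hstandard rfl htake_src.symm rfl))

end Arrow

/-- The open subgroupoid of the arrows `[α, m, β; x]` with `|α| = |β| = N`. -/
noncomputable def levelSubgroupoid (hAB : PseudoFree A B) (N : ℕ) :
    (kernelGroupoid hAB).OpenSubgroupoid where
  carrier := {g : {g : Arrow A B // g.degree = 0} | g.1.IsLevel N}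
  isOpen_carrier := (Arrow.isOpen_isLevel N).preimage
    (rho hAB).isLocalHomeomorph_kerVal.continuous
  one_mem x := Arrow.isLevel_one N x
  inv_mem _ hg := Arrow.IsLevel.inv hg
  mul_mem g hg h hh hgh := by
    change Arrow.IsLevel N ((rho hAB).kerMul g h).1
    rw [(rho hAB).kerMul_val g h hgh]
    exact Arrow.IsLevel.mul hg hh hgh

theorem levelSubgroupoid_val_mul (hAB : PseudoFree A B) (N : ℕ)
    (g h : (levelSubgroupoid hAB N).carrier) (hgh : Arrow.src g.1.1 = Arrow.rng h.1.1) :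
    ((levelSubgroupoid hAB N).subMul g h).1.1 = Arrow.mul g.1.1 h.1.1 := by
  rw [(levelSubgroupoid hAB N).subMul_val g h hgh]
  exact (rho hAB).kerMul_val g.1 h.1 hgh

/-- The cocycle `[α, m, β; x] ↦ m` on the arrows with `|α| = |β| = N`. -/
noncomputable def levelCocycle (hAB : PseudoFree A B) (N : ℕ) :
    (levelSubgroupoid hAB N).toGroupoid.IntHom where
  toFun g := Arrow.levelDeg N g.1.1
  map_mul g h hgh := (congrArg (Arrow.levelDeg N) (levelSubgroupoid_val_mul hAB N g h hgh)).trans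
    (Arrow.levelDeg_mul hAB g.2 h.2 hgh)
  continuous_toFun := by
    have hval : Continuous fun h : (levelSubgroupoid hAB N).toGroupoid.Arr => h.1.1 :=
      (rho hAB).isLocalHomeomorph_kerVal.continuous.comp
        (levelSubgroupoid hAB N).isLocalHomeomorph_val.continuous
    exact ((IsLocallyConstant.iff_eventually_eq _).2 fun g =>
      hval.continuousAt.eventually (Arrow.eventually_levelDeg_eq hAB g.2)).continuous

/-- The section `(x, k) ↦ ([μ, k, β; x], 0)` of the skew product by `levelCocycle`. -/
noncomputable def levelContractingSection (hAB : PseudoFree A B) (N : ℕ) :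
    (levelCocycle hAB N).skewProduct.ContractingSection where
  sec p := (⟨⟨Arrow.levelSection B N p.2 p.1, Arrow.degree_levelSection (B := B) N p.2 p.1⟩,
    Arrow.isLevel_levelSection (B := B) N p.2 p.1⟩, 0)
  src_sec p := Prod.ext rfl ((zero_add _).trans (Arrow.levelDeg_levelSection hAB N p.2 p.1))
  sec_mul g := Prod.ext (Subtype.ext (Subtype.ext
    ((levelSubgroupoid_val_mul hAB N _ g.1 rfl).trans (Arrow.levelSection_mul hAB g.2 g.1.2)))) rfl
  continuous_sec := by
    refine Continuous.prodMk (Continuous.subtype_mk (Continuous.subtype_mk ?_ _) _) continuous_const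
    exact continuous_prod_of_discrete_right.2 fun k => Arrow.continuous_levelSection N k

theorem directed_levelSubgroupoid (hAB : PseudoFree A B) :
    Directed (· ⊆ ·) fun N => (levelSubgroupoid hAB N).carrier :=
  (monotone_nat_of_le_succ fun _ _ hg => Arrow.IsLevel.succ hg).directed_le

theorem exists_mem_levelSubgroupoid (hAB : PseudoFree A B) (g : (kernelGroupoid hAB).Arr) :
    ∃ N, g ∈ (levelSubgroupoid hAB N).carrier :=
  Arrow.exists_isLevel g.2

theorem subsingleton_homology_levelSubgroupoid (hAB : PseudoFree A B) (N n : ℕ) :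
    Subsingleton ((levelSubgroupoid hAB N).toGroupoid.Homology (n + 2)) :=
  (levelCocycle hAB N).subsingleton_homology_succ_of_skewProduct
    ((levelContractingSection hAB N).subsingleton_homology_succ n)
    ((levelContractingSection hAB N).subsingleton_homology_succ (n + 1))

end Katsura

theorem mainTheorem6_general {V : Type u} {A B : Matrix V V ℤ} (hAB : Katsura.PseudoFree A B)
    {i : ℕ} (hi : 2 ≤ i) : Subsingleton ((Katsura.kernelGroupoid hAB).Homology i) := by
  obtain ⟨n, rfl⟩ := Nat.exists_eq_add_of_le' hi
  exact EtaleGroupoid.subsingleton_homology_of_directed (Katsura.directed_levelSubgroupoid hAB)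
    (Katsura.exists_mem_levelSubgroupoid hAB)
    fun N => Katsura.subsingleton_homology_levelSubgroupoid hAB N n

theorem mainTheorem6 {V : Type*} [Countable V] (A B : Matrix V V ℤ)
    (hA_nonneg : ∀ i j, 0 ≤ A i j)
    (hA_rowFinite : Katsura.RowFinite A) (hB_rowFinite : Katsura.RowFinite B)
    (hA_rows : ∀ i, ∃ j, A i j ≠ 0) (hB_rows : ∀ i, ∃ j, B i j ≠ 0)
    (hAB : Katsura.PseudoFree A B) (i : ℕ) (hi : 2 ≤ i) :
    Subsingleton ((Katsura.kernelGroupoid hAB).Homology i) :=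
  mainTheorem6_general hAB hi
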